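/- Let $p$ be a prime and let $K$ be a non-archimedean local field of characteristic $p$, with ring of integers $\mathcal{O}_K$, maximal ideal $\mathcal{P}_K=\pi\mathcal{O}_K$ ($\pi$ a fixed uniformizer) and residue field of cardinality $q$. For $x\in\mathcal{O}_K\setminus\{0\}$ write $x=ac(x)\,\pi^{\mathrm{ord}(x)}$ with $ac(x)\in\mathcal{O}_K^\times$, and put $|x|=q^{-\mathrm{ord}(x)}$, $|0|=0$. Let $\chi:\mathcal{O}_K^\times\to\mathbb{C}^\times$ be a continuous character, and put $\chi(ac(0))=0$. For $f\in\mathcal{O}_K[x,y]$ and $\mathrm{Re}(s)>0$ let $$Z_f(s,\chi)=\int_{\mathcal{O}_K^2}\chi(ac\,f(x,y))\,|f(x,y)|^s\,|dx\,dy|,$$ where $|dx\,dy|$ is the Haar measure giving $\mathcal{O}_K^2$ measure one. Let $d\ge 0$ and $m\ge 2$ be integers with $p\nmid m$, let $\mu_1\in\mathcal{O}_K^\times$, let $\mu_2\in\mathcal{O}_K$ with $\mu_2\neq 0$, and let $h_0\in\mathcal{O}_K[x]$ be either zero or such that every monomial occurring in $h_0$ has degree at least $d+1$. Put $$h(x,y)=\mu_1x^d+\mu_2y^m+\pi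 h_0(x),\qquad h_1(x,y)=\mu_1x^d+\mu_2y^m,$$ $\tilde d=d/\gcd(d,m)$ and $\tilde m=m/\gcd(d,m)$. Then: 1. If $d\le 1$, there is a polynomial $H_1\in\mathbb{C}[x]$ such that for all $s$ with $\mathrm{Re}(s)>0$ $$Z_h(s,\chi)=\frac{H_1(q^{-s})}{1-q^{-1-s}}.$$ 2. If $d\ge 2$, there is a polynomial $H_2\in\mathbb{C}[x]$ such that for all $s$ with $\mathrm{Re}(s)>0$ $$Z_h(s,\chi)=\frac{H_2(q^{-s})}{(1-q^{-1-s})(1-q^{-\tilde d-\tilde m-\tilde d\tilde m\gcd(d,m)s})}.$$ 3. If $d\ge 2$ and moreover $p\nmid d$ or $\chi$ is trivial on $1+\mathcal{P}_K$, then $Z_h(s,\chi)=Z_{h_1}(s,\chi)$ for all $s$ with $\mathrm{Re}(s)>0$. -/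

import Mathlib

open scoped ValuativeRel
open MeasureTheory

noncomputable section

namespace IgusaZeta

variable (K : Type*) [Field K] [ValuativeRel K] [TopologicalSpace K]
  [IsNonarchimedeanLocalField K]

/-- The cardinality `q` of the residue field of `K`. -/
def residueCard : ℕ := Nat.card 𝓀[K]

/-- The normalized Haar measure on the compact additive group of integers (total mass one). -/
def integerHaar [MeasurableSpace K] [BorelSpace K] : Measure 𝒪[K] :=
  Measure.addHaarMeasure (⊤ : TopologicalSpace.PositiveCompacts 𝒪[K])

/-- The Haar measure `|dx|` on `K ^ n`, normalized so that `𝒪 ^ n` has measure one, restricted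
to `𝒪 ^ n`; it is the product of the normalized Haar measures of the factors. -/
def integerHaarPow [MeasurableSpace K] [BorelSpace K] (n : ℕ) : Measure (Fin n → 𝒪[K]) :=
  Measure.pi fun _ => integerHaar K

variable {K}

/-- The absolute value `|x| = q ^ (- ord x)` of an integer `x` of `K`, with `|0| = 0`. -/
def absVal (x : 𝒪[K]) : ℝ :=
  open Classical in
  if x = 0 then 0
  else ((residueCard K : ℝ)⁻¹) ^ (IsDiscreteValuationRing.addVal 𝒪[K] x).toNat

/-- The angular component of an integer `x` of `K` with respect to the uniformizer `ϖ`: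
the unit `u` with `x = u * ϖ ^ ord x` if `x ≠ 0`, and `0` if `x = 0`. -/
def angularComponent (ϖ x : 𝒪[K]) : 𝒪[K] :=
  open Classical in
  if h : ∃ u : 𝒪[K]ˣ, ∃ k : ℕ, x = (u : 𝒪[K]) * ϖ ^ k then (h.choose : 𝒪[K]) else 0

/-- Igusa's local zeta function
`Z_f(s, χ) = ∫_{𝒪 ^ n} χ(ac f(x)) |f(x)| ^ s |dx|` (meant for `0 < re s`), where `χ` is extended
by `χ(0) = 0`. -/
def zeta [MeasurableSpace K] [BorelSpace K] {n : ℕ} (ϖ : 𝒪[K]) (χ : 𝒪[K]ˣ →* ℂˣ)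
    (f : MvPolynomial (Fin n) 𝒪[K]) (s : ℂ) : ℂ :=
  ∫ x : Fin n → 𝒪[K],
    MulChar.ofUnitHom χ (angularComponent ϖ (MvPolynomial.eval x f)) *
      (absVal (MvPolynomial.eval x f) : ℂ) ^ s ∂(integerHaarPow K n)

/-- The two-variable polynomial `μ₁ x ^ d + μ₂ y ^ m + ϖ h₀(x)`. -/
def hPoly (ϖ μ₁ μ₂ : 𝒪[K]) (d m : ℕ) (h₀ : Polynomial 𝒪[K]) : MvPolynomial (Fin 2) 𝒪[K] :=
  MvPolynomial.C μ₁ * MvPolynomial.X 0 ^ d + MvPolynomial.C μ₂ * MvPolynomial.X 1 ^ m +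
    MvPolynomial.C ϖ * Polynomial.aeval (MvPolynomial.X 0) h₀

/-- The two-variable polynomial `μ₁ x ^ d + μ₂ y ^ m`. -/
def h₁Poly (μ₁ μ₂ : 𝒪[K]) (d m : ℕ) : MvPolynomial (Fin 2) 𝒪[K] :=
  MvPolynomial.C μ₁ * MvPolynomial.X 0 ^ d + MvPolynomial.C μ₂ * MvPolynomial.X 1 ^ m

end IgusaZeta

end

/-!
Put `z = q ^ (-s)`. Because `m` is a unit, a factor `v ≡ 1 mod ϖ` is an `m`-th power `u ^ m`;
substituting `u * y` for `y` turns `h = μ₁ * x ^ d * v(x) + μ₂ * y ^ m` into `v(x)` times the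
binomial `μ₁ * x ^ d + μ₂ * y ^ m`, at the cost of the weight `χ (v x)`, which is `1` for small `x`.

The substitution `(x, y) ↦ (ϖ ^ a * x, ϖ ^ b * y)`, with `d * a = m * b`, multiplies the binomial by
`ϖ ^ (d * a)` and the measure by `q ^ (-(a + b))`; iterating it makes the weight trivial and yields
the second denominator. On the complement of `ϖ ^ a 𝒪 × ϖ ^ b 𝒪` the binomial can be small only
where `y` is bounded away from `0`, and there `y ↦ μ₂ * y ^ m` is, up to scaling, a local isometry.
Hence the small values of the binomial are equidistributed, and they contribute a multiple of
`∑ k, (z / q) ^ k = 1 / (1 - z / q)`.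
-/

open Filter Topology IsLocalRing

namespace IgusaZeta

section Ball

variable {R : Type*} [CommRing R] [IsLocalRing R]

/-- The ball `a + 𝔪 ^ n` in a local ring with maximal ideal `𝔪`. -/
def ball (n : ℕ) (a : R) : Set R := {x | x - a ∈ maximalIdeal R ^ n}

lemma mem_ball {n : ℕ} {a x : R} : x ∈ ball n a ↔ x - a ∈ maximalIdeal R ^ n := Iff.rfl

lemma mem_ball_self (n : ℕ) (a : R) : a ∈ ball n a := by simp [mem_ball]

lemma ball_zero (n : ℕ) : ball n (0 : R) = ↑(maximalIdeal R ^ n) := by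
  ext x
  simp [mem_ball]

lemma add_mem_ball_zero_iff {n : ℕ} {x y : R} (hy : y ∈ ball n 0) :
    x + y ∈ ball n 0 ↔ x ∈ ball n 0 := by
  rw [ball_zero] at *
  exact Ideal.add_mem_iff_left _ hy

lemma mem_ball_zero_iff_of_associated {n : ℕ} {x y : R} (h : Associated x y) :
    x ∈ ball n 0 ↔ y ∈ ball n 0 := by
  rw [ball_zero]
  exact Ideal.mem_iff_of_associated h

lemma ball_eq_of_mem {n : ℕ} {a x : R} (h : x ∈ ball n a) : ball n x = ball n a := by
  ext y
  rw [mem_ball, mem_ball, ← sub_add_sub_cancel y x a, Ideal.add_mem_iff_left _ h]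

lemma ball_antitone (a : R) : Antitone fun n => ball n a :=
  fun _ _ h _ hx => Ideal.pow_le_pow_right h hx

lemma isPiSystem_balls : IsPiSystem {s : Set R | ∃ n a, s = ball n a} := by
  rintro _ ⟨n, a, rfl⟩ _ ⟨k, b, rfl⟩ ⟨x, hxa, hxb⟩
  rw [← ball_eq_of_mem hxa, ← ball_eq_of_mem hxb]
  rcases le_total n k with h | h
  · exact ⟨k, x, Set.inter_eq_right.mpr (ball_antitone x h)⟩
  · exact ⟨n, x, Set.inter_eq_left.mpr (ball_antitone x h)⟩

variable [IsNoetherianRing R] [TopologicalSpace R] [IsTopologicalRing R] [CompactSpace R]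
  [T2Space R]

lemma isClopen_ball (n : ℕ) (a : R) : IsClopen (ball n a) :=
  IsClopen.preimage ⟨IsNoetherianRing.isClosed_ideal _, isOpen_maximalIdeal_pow R n⟩
    (continuous_id.sub continuous_const)

lemma nhds_hasBasis_ball (a : R) : (𝓝 a).HasBasis (fun _ : ℕ => True) fun n => ball n a := by
  refine ⟨fun U => ⟨fun hU => ?_, fun ⟨n, _, hn⟩ =>
    mem_of_superset ((isClopen_ball n a).2.mem_nhds (mem_ball_self n a)) hn⟩⟩
  have hinter : ⋂ n, ball n a ⊆ {a} := fun x hx => by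
    have h : x - a ∈ ⨅ n, maximalIdeal R ^ n := by
      simpa [Submodule.mem_iInf, mem_ball] using hx
    rwa [Ideal.iInf_pow_eq_bot_of_isLocalRing _ (maximalIdeal.isMaximal R).ne_top,
      Ideal.mem_bot, sub_eq_zero] at h
  obtain ⟨n, hn⟩ := exists_subset_nhds_of_compactSpace (U := U)
    (ball_antitone a).directed_ge (fun n => (isClopen_ball n a).1)
    fun x hx => (hinter hx : x = a) ▸ hU
  exact ⟨n, trivial, hn⟩

lemma isTopologicalBasis_balls :
    TopologicalSpace.IsTopologicalBasis {s : Set R | ∃ n a, s = ball n a} := by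
  refine TopologicalSpace.isTopologicalBasis_of_isOpen_of_nhds ?_ fun a U ha hU => ?_
  · rintro _ ⟨n, a, rfl⟩
    exact (isClopen_ball n a).2
  · obtain ⟨n, -, hn⟩ := (nhds_hasBasis_ball a).mem_iff.mp (hU.mem_nhds ha)
    exact ⟨_, ⟨n, a, rfl⟩, mem_ball_self n a, hn⟩

lemma finite_quotient_maximalIdeal_pow (n : ℕ) : Finite (R ⧸ maximalIdeal R ^ n) :=
  isOpen_iff_finite_quotient.mp (isOpen_maximalIdeal_pow R n)

instance : SecondCountableTopology R := by
  refine isTopologicalBasis_balls.secondCountableTopology ?_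
  have hfin : ∀ n, (Set.range (ball n : R → Set R)).Finite := fun n => by
    have := finite_quotient_maximalIdeal_pow (R := R) n
    refine (Set.finite_range fun b : R ⧸ maximalIdeal R ^ n =>
      Ideal.Quotient.mk _ ⁻¹' {b}).subset ?_
    rintro _ ⟨a, rfl⟩
    exact ⟨Ideal.Quotient.mk _ a, Set.ext fun x => by simp [Ideal.Quotient.eq, mem_ball]⟩
  refine (Set.countable_iUnion fun n => (hfin n).countable).mono ?_
  rintro _ ⟨n, a, rfl⟩
  exact Set.mem_iUnion.mpr ⟨n, a, rfl⟩

lemma measure_ext_of_ball [MeasurableSpace R] [BorelSpace R] {μ ν : Measure R}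
    [IsFiniteMeasure μ] (h : ∀ n a, μ (ball n a) = ν (ball n a)) : μ = ν := by
  refine ext_of_generate_finite _ (BorelSpace.measurable_eq.trans
    isTopologicalBasis_balls.borel_eq_generateFrom) isPiSystem_balls ?_ ?_
  · rintro _ ⟨n, a, rfl⟩
    exact h n a
  · have huniv : ball 0 (0 : R) = Set.univ := Set.eq_univ_of_forall fun x => by simp [mem_ball]
    exact huniv ▸ h 0 0

section ValuationPreserving

variable {φ : R → R} (hφ : ∀ n x y, φ x - φ y ∈ maximalIdeal R ^ n ↔ x - y ∈ maximalIdeal R ^ n)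
include hφ

lemma continuous_of_sub_mem_iff : Continuous φ :=
  continuous_iff_continuousAt.mpr fun a =>
    ((nhds_hasBasis_ball a).tendsto_iff (nhds_hasBasis_ball (φ a))).mpr
      fun n _ => ⟨n, trivial, fun x hx => (hφ n x a).mpr hx⟩

lemma surjective_of_sub_mem_iff : Function.Surjective φ := fun a => by
  have hmem : a ∈ closure (Set.range φ) := by
    refine (mem_closure_iff_nhds_basis (nhds_hasBasis_ball a)).mpr fun n _ => ?_
    have := finite_quotient_maximalIdeal_pow (R := R) n
    let ψ : R ⧸ maximalIdeal R ^ n → R ⧸ maximalIdeal R ^ n :=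
      fun b => Ideal.Quotient.mk _ (φ b.out)
    have hψ : Function.Injective ψ := fun b c h => by
      rw [← b.out_eq', ← c.out_eq']
      exact Ideal.Quotient.eq.mpr ((hφ n _ _).mp (Ideal.Quotient.eq.mp h))
    obtain ⟨b, hb⟩ := Finite.surjective_of_injective hψ (Ideal.Quotient.mk _ a)
    exact ⟨φ b.out, ⟨_, rfl⟩, Ideal.Quotient.eq.mp hb⟩
  rwa [(isCompact_range (continuous_of_sub_mem_iff hφ)).isClosed.closure_eq] at hmem

lemma measurePreserving_of_sub_mem_iff [MeasurableSpace R] [BorelSpace R] (μ : Measure R)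
    [μ.IsAddHaarMeasure] : MeasurePreserving φ μ μ := by
  have hcont := continuous_of_sub_mem_iff hφ
  refine ⟨hcont.measurable, (measure_ext_of_ball fun n a => ?_).symm⟩
  obtain ⟨b, rfl⟩ := surjective_of_sub_mem_iff hφ a
  have hpre : φ ⁻¹' ball n (φ b) = (fun x => φ b - b + x) ⁻¹' ball n (φ b) := by
    ext x
    rw [Set.mem_preimage, Set.mem_preimage, mem_ball, mem_ball, hφ]
    ring_nf
  rw [Measure.map_apply hcont.measurable (isClopen_ball n _).2.measurableSet, hpre,
    measure_preimage_add]

end ValuationPreserving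

end Ball

section ValuationRing

variable {R : Type*} [CommRing R] [IsDomain R] [IsDiscreteValuationRing R] {ϖ : R}

lemma mem_maximalIdeal_pow_iff (hϖ : Irreducible ϖ) {n : ℕ} {x : R} :
    x ∈ maximalIdeal R ^ n ↔ ϖ ^ n ∣ x := by
  rw [hϖ.maximalIdeal_eq, Ideal.span_singleton_pow, Ideal.mem_span_singleton]

lemma mem_ball_iff_dvd (hϖ : Irreducible ϖ) {n : ℕ} {a x : R} : x ∈ ball n a ↔ ϖ ^ n ∣ x - a := by
  rw [mem_ball, mem_maximalIdeal_pow_iff hϖ]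

lemma mem_ball_zero_iff_dvd (hϖ : Irreducible ϖ) {n : ℕ} {x : R} : x ∈ ball n 0 ↔ ϖ ^ n ∣ x := by
  rw [mem_ball_iff_dvd hϖ, sub_zero]

lemma range_pow_mul (hϖ : Irreducible ϖ) (n : ℕ) :
    Set.range (fun x : R => ϖ ^ n * x) = ball n 0 :=
  Set.ext fun _ => (mem_ball_zero_iff_dvd hϖ).trans (exists_congr fun _ => eq_comm) |>.symm

lemma isUnit_or_dvd (hϖ : Irreducible ϖ) (x : R) : IsUnit x ∨ ϖ ∣ x := by
  rw [or_iff_not_imp_left]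
  intro hx
  simpa using (mem_maximalIdeal_pow_iff hϖ (n := 1)).mp (by simpa using hx)

lemma isUnit_of_dvd_sub (hϖ : Irreducible ϖ) {x y : R} (h : ϖ ∣ x - y) (hy : IsUnit y) :
    IsUnit x :=
  (isUnit_or_dvd hϖ x).resolve_right fun hx =>
    hϖ.not_isUnit (isUnit_of_dvd_unit ((dvd_sub_right hx).mp h) hy)

lemma card_quotient_maximalIdeal_pow [Finite (ResidueField R)] (n : ℕ) :
    Nat.card (R ⧸ maximalIdeal R ^ n) = Nat.card (ResidueField R) ^ n :=
  cardQuot_pow_of_prime (IsDiscreteValuationRing.not_a_field R)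

end ValuationRing

section Haar

lemma integrable_of_continuous {X : Type*} [TopologicalSpace X] [CompactSpace X]
    [MeasurableSpace X] [OpensMeasurableSpace X] (μ : Measure X) [IsFiniteMeasureOnCompacts μ]
    {F : X → ℂ} (hF : Continuous F) : Integrable F μ :=
  hF.integrable_of_hasCompactSupport (HasCompactSupport.of_compactSpace F)

lemma one_sub_natCast_inv_mul_ne_zero (n : ℕ) {z : ℂ} (hz : ‖z‖ < 1) : 1 - (n : ℂ)⁻¹ * z ≠ 0 := by
  refine sub_ne_zero.mpr fun h => hz.not_ge ?_
  calc (1 : ℝ) = (n : ℝ)⁻¹ * ‖z‖ := by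
        rw [← norm_one (α := ℂ), h, norm_mul, norm_inv, Complex.norm_natCast]
    _ ≤ 1 * ‖z‖ := by gcongr; exact Nat.cast_inv_le_one n
    _ = ‖z‖ := one_mul _

lemma setIntegral_range_addMonoidHom {G H : Type*} [AddGroup G] [TopologicalSpace G]
    [IsTopologicalAddGroup G] [CompactSpace G] [MeasurableSpace G] [BorelSpace G]
    [AddGroup H] [TopologicalSpace H] [IsTopologicalAddGroup H] [T2Space H]
    [MeasurableSpace H] [BorelSpace H] (μ : Measure G) [μ.IsAddHaarMeasure]
    [IsProbabilityMeasure μ] (ν : Measure H) [IsFiniteMeasure ν] [ν.IsAddLeftInvariant]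
    {f : G →+ H} (hf : Continuous f) (hinj : Function.Injective f) (F : H → ℂ) :
    ∫ x in Set.range f, F x ∂ν = ν.real (Set.range f) * ∫ x, F (f x) ∂μ := by
  have hemb : MeasurableEmbedding f := (hf.isClosedEmbedding hinj).measurableEmbedding
  have := Measure.IsAddLeftInvariant.comap ν hemb
  have hcomap := Measure.isAddInvariant_eq_smul_of_compactSpace (ν.comap f) μ
  have hmass : ((ν.comap f).addHaarScalarFactor μ : ℝ) = ν.real (Set.range f) := by
    have h := congrArg (fun ρ : Measure G => ρ.real Set.univ) hcomap
    simpa [measureReal_def, hemb.comap_apply] using h.symm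
  rw [← hemb.map_comap ν, hemb.integral_map, hcomap, integral_smul_nnreal_measure,
    NNReal.smul_def, hmass, Complex.real_smul]

variable {R : Type*} [CommRing R] [IsDomain R] [IsDiscreteValuationRing R] [TopologicalSpace R]
  [IsTopologicalRing R] [CompactSpace R] [T2Space R] [MeasurableSpace R] [BorelSpace R]
  (μ : Measure R) [μ.IsAddHaarMeasure]

lemma integral_comp_of_associated_sub {φ : R → R}
    (hφ : ∀ x y, Associated (φ x - φ y) (x - y)) {F : R → ℂ} (hF : Continuous F) :
    ∫ x, F (φ x) ∂μ = ∫ x, F x ∂μ := by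
  have h := measurePreserving_of_sub_mem_iff
    (fun n x y => (maximalIdeal R ^ n).mem_iff_of_associated (hφ x y)) μ
  rw [← integral_map h.measurable.aemeasurable hF.aestronglyMeasurable, h.map_eq]

variable [IsProbabilityMeasure μ]

lemma measureReal_ball_zero (n : ℕ) :
    μ.real (ball n 0) = ((Nat.card (ResidueField R) : ℝ)⁻¹) ^ n := by
  have : Finite (R ⧸ (maximalIdeal R ^ n).toAddSubgroup) := finite_quotient_maximalIdeal_pow n
  have := AddSubgroup.finiteIndex_of_finite_quotient (H := (maximalIdeal R ^ n).toAddSubgroup)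
  have hindex : (maximalIdeal R ^ n).toAddSubgroup.index = Nat.card (ResidueField R) ^ n :=
    card_quotient_maximalIdeal_pow n
  have hcoe : ball n (0 : R) = (maximalIdeal R ^ n).toAddSubgroup := ball_zero n
  have h := AddSubgroup.index_mul_measure (maximalIdeal R ^ n).toAddSubgroup
    (hcoe ▸ (isClopen_ball n 0).2.measurableSet) μ
  rw [hindex, measure_univ, ← hcoe] at h
  rw [inv_pow]
  refine eq_inv_of_mul_eq_one_right ?_
  simpa [measureReal_def] using congrArg ENNReal.toReal h

lemma setIntegral_ball_zero {ϖ : R} (hϖ : Irreducible ϖ) (n : ℕ) (F : R → ℂ) :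
    ∫ x in ball n 0, F x ∂μ =
      ((Nat.card (ResidueField R) : ℂ)⁻¹) ^ n * ∫ x, F (ϖ ^ n * x) ∂μ := by
  have h := setIntegral_range_addMonoidHom μ μ (f := AddMonoidHom.mulLeft (ϖ ^ n))
    (continuous_const_mul _) (mul_right_injective₀ (pow_ne_zero n hϖ.ne_zero)) F
  have hrange : Set.range (AddMonoidHom.mulLeft (ϖ ^ n)) = ball n 0 := range_pow_mul hϖ n
  rw [hrange, measureReal_ball_zero] at h
  simpa using h

lemma setIntegral_ball_zero_prod {ϖ : R} (hϖ : Irreducible ϖ) (a b : ℕ) (F : R × R → ℂ) :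
    ∫ p in ball a 0 ×ˢ ball b 0, F p ∂μ.prod μ =
      ((Nat.card (ResidueField R) : ℂ)⁻¹) ^ (a + b) *
        ∫ p, F (ϖ ^ a * p.1, ϖ ^ b * p.2) ∂μ.prod μ := by
  have hinj (n : ℕ) := mul_right_injective₀ (pow_ne_zero n hϖ.ne_zero)
  have h := setIntegral_range_addMonoidHom (μ.prod μ) (μ.prod μ)
    (f := (AddMonoidHom.mulLeft (ϖ ^ a)).prodMap (AddMonoidHom.mulLeft (ϖ ^ b)))
    ((continuous_const_mul _).prodMap (continuous_const_mul _)) ((hinj a).prodMap (hinj b)) F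
  have hrange : Set.range ((AddMonoidHom.mulLeft (ϖ ^ a)).prodMap (AddMonoidHom.mulLeft (ϖ ^ b))) =
      ball a 0 ×ˢ ball b 0 := by
    rw [← range_pow_mul hϖ, ← range_pow_mul hϖ, ← Set.range_prodMap]
    rfl
  rw [hrange, measureReal_prod_prod, measureReal_ball_zero, measureReal_ball_zero, ← pow_add] at h
  simpa [Prod.map_def] using h

end Haar

section Character

lemma eq_one_of_forall_norm_pow_sub_one_le {z : ℂ} (h : ∀ n : ℕ, ‖z ^ n - 1‖ ≤ 1 / 2) :
    z = 1 := by
  by_contra hz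
  have hpos : 0 < ‖z - 1‖ := norm_pos_iff.mpr (sub_ne_zero.mpr hz)
  have hgrowth (k : ℕ) : (3 / 2 : ℝ) ^ k * ‖z - 1‖ ≤ ‖z ^ (2 ^ k) - 1‖ := by
    induction k with
    | zero => simp
    | succ k ih =>
      have hfactor : z ^ (2 ^ (k + 1)) - 1 = (2 + (z ^ (2 ^ k) - 1)) * (z ^ (2 ^ k) - 1) := by
        rw [pow_succ, pow_mul]; ring
      have hlower : (3 / 2 : ℝ) ≤ ‖2 + (z ^ (2 ^ k) - 1)‖ := by
        have := norm_sub_le_norm_add (2 : ℂ) (z ^ (2 ^ k) - 1)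
        rw [Complex.norm_ofNat] at this
        linarith [h (2 ^ k)]
      rw [hfactor, norm_mul, pow_succ', mul_assoc]
      gcongr
  obtain ⟨k, hk⟩ := pow_unbounded_of_one_lt (1 / ‖z - 1‖) (by norm_num : (1 : ℝ) < 3 / 2)
  rw [div_lt_iff₀ hpos] at hk
  linarith [hgrowth k, h (2 ^ k)]

lemma norm_eq_one_of_continuous {G : Type*} [Group G] [TopologicalSpace G] [CompactSpace G]
    {χ : G →* ℂˣ} (hχ : Continuous χ) (g : G) : ‖(χ g : ℂ)‖ = 1 := by
  obtain ⟨C, hC⟩ := (isCompact_range (Units.continuous_val.comp hχ).norm).bddAbove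
  have hle (g : G) : ‖(χ g : ℂ)‖ ≤ 1 := by
    by_contra! hlt
    obtain ⟨n, hn⟩ := pow_unbounded_of_one_lt C hlt
    refine hn.not_ge (hC ⟨g ^ n, ?_⟩)
    simp
  refine le_antisymm (hle g) ?_
  rw [← inv_inv (χ g), ← map_inv, Units.val_inv_eq_inv_val, norm_inv]
  exact (one_le_inv₀ (norm_pos_iff.mpr (χ g⁻¹).ne_zero)).mpr (hle g⁻¹)

variable {R : Type*} [CommRing R] [IsLocalRing R] [IsNoetherianRing R] [TopologicalSpace R]
  [IsTopologicalRing R] [CompactSpace R] [T2Space R]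

lemma exists_conductor {χ : Rˣ →* ℂˣ} (hχ : Continuous χ) :
    ∃ c : ℕ, ∀ u : Rˣ, (u : R) - 1 ∈ maximalIdeal R ^ c → χ u = 1 := by
  have hU : {u : Rˣ | ‖(χ u : ℂ) - 1‖ ≤ 1 / 2} ∈ 𝓝 (1 : Rˣ) := by
    have hcont : Continuous fun u => ‖(χ u : ℂ) - 1‖ := by
      have := Units.continuous_val.comp hχ
      fun_prop
    exact hcont.continuousAt.preimage_mem_nhds (Iic_mem_nhds (by simp))
  have hval : IsClosedEmbedding (Units.val : Rˣ → R) :=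
    Units.continuous_val.isClosedEmbedding Units.val_injective
  rw [hval.isInducing.nhds_eq_comap] at hU
  obtain ⟨c, -, hc⟩ := ((nhds_hasBasis_ball _).comap _).mem_iff.mp hU
  refine ⟨c, fun u hu => Units.ext (eq_one_of_forall_norm_pow_sub_one_le fun n => ?_)⟩
  rw [← Units.val_pow_eq_pow_val, ← map_pow]
  refine hc ?_
  rw [Set.mem_preimage, mem_ball, Units.val_one, Units.val_pow_eq_pow_val]
  exact Ideal.mem_of_dvd _ (by simpa using sub_dvd_pow_sub_pow (u : R) 1 n) hu

end Character

section QuasiChar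

open Classical in
/-- The quasi-character `t ↦ χ (ac t) |t| ^ s` of a discrete valuation ring with uniformizer `ϖ`,
extended by zero. The exponent is replaced by `z = q ^ (-s)`, so that `u * ϖ ^ k`, with `u` a unit,
is sent to `χ u * z ^ k`; at `z = 0` this is the character `χ` supported on the units. -/
noncomputable def quasiChar {R : Type*} [CommRing R] (ϖ : R) (χ : Rˣ →* ℂˣ) (z : ℂ) (t : R) : ℂ :=
  if h : ∃ p : Rˣ × ℕ, t = p.1 * ϖ ^ p.2 then χ h.choose.1 * z ^ h.choose.2 else 0

/-- The summand of `quasiChar` over the elements of valuation exactly `k`, stripped of its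
factor `z ^ k`. -/
noncomputable def layer {R : Type*} [CommRing R] [IsLocalRing R] (ϖ : R) (χ : Rˣ →* ℂˣ) (k : ℕ) :
    R → ℂ :=
  (ball k 0 \ ball (k + 1) 0).indicator (quasiChar ϖ χ 1)

variable {R : Type*} [CommRing R] [IsDomain R] [IsDiscreteValuationRing R] {ϖ : R}
  (hϖ : Irreducible ϖ)
include hϖ

section Algebra

variable (χ : Rˣ →* ℂˣ) (z : ℂ)

lemma quasiChar_unit_mul_pow (u : Rˣ) (k : ℕ) : quasiChar ϖ χ z (u * ϖ ^ k) = χ u * z ^ k := by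
  have h : ∃ p : Rˣ × ℕ, (u * ϖ ^ k : R) = p.1 * ϖ ^ p.2 := ⟨(u, k), rfl⟩
  rw [quasiChar, dif_pos h,
    ← IsDiscreteValuationRing.unit_mul_pow_congr_unit hϖ u _ k _ h.choose_spec,
    ← IsDiscreteValuationRing.unit_mul_pow_congr_pow hϖ hϖ u _ k _ h.choose_spec]

lemma quasiChar_zero : quasiChar ϖ χ z 0 = 0 :=
  dif_neg fun ⟨p, h⟩ => mul_ne_zero p.1.ne_zero (pow_ne_zero p.2 hϖ.ne_zero) h.symm

lemma quasiChar_unit (u : Rˣ) : quasiChar ϖ χ z u = χ u := by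
  simpa using quasiChar_unit_mul_pow hϖ χ z u 0

lemma quasiChar_mul (s t : R) :
    quasiChar ϖ χ z (s * t) = quasiChar ϖ χ z s * quasiChar ϖ χ z t := by
  rcases eq_or_ne s 0 with rfl | hs
  · simp [quasiChar_zero hϖ]
  rcases eq_or_ne t 0 with rfl | ht
  · simp [quasiChar_zero hϖ]
  obtain ⟨k, u, rfl⟩ := IsDiscreteValuationRing.eq_unit_mul_pow_irreducible hs hϖ
  obtain ⟨n, v, rfl⟩ := IsDiscreteValuationRing.eq_unit_mul_pow_irreducible ht hϖ
  have hmul : (u * ϖ ^ k * (v * ϖ ^ n) : R) = ((u * v : Rˣ) : R) * ϖ ^ (k + n) := by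
    push_cast; ring
  rw [hmul, quasiChar_unit_mul_pow hϖ, quasiChar_unit_mul_pow hϖ, quasiChar_unit_mul_pow hϖ,
    map_mul, Units.val_mul, pow_add]
  ring

lemma quasiChar_pow_mul (k : ℕ) (t : R) :
    quasiChar ϖ χ z (ϖ ^ k * t) = z ^ k * quasiChar ϖ χ z t := by
  simpa [quasiChar_mul hϖ] using
    congrArg (· * quasiChar ϖ χ z t) (quasiChar_unit_mul_pow hϖ χ z 1 k)

lemma quasiChar_eq_pow_mul_layer {k : ℕ} {t : R} (ht : t ∈ ball k 0 \ ball (k + 1) 0) :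
    quasiChar ϖ χ z t = z ^ k * layer ϖ χ k t := by
  rw [layer, Set.indicator_of_mem ht]
  obtain ⟨hk, hk'⟩ := ht
  rw [mem_ball_zero_iff_dvd hϖ] at hk hk'
  obtain ⟨s, rfl⟩ := hk
  obtain ⟨u, rfl⟩ : IsUnit s := (isUnit_or_dvd hϖ s).resolve_right fun hs =>
    hk' (pow_succ ϖ k ▸ mul_dvd_mul_left _ hs)
  simp only [quasiChar_pow_mul hϖ, quasiChar_unit hϖ, one_pow, one_mul]

lemma quasiChar_eq_sum_layer_add (M : ℕ) (t : R) :
    quasiChar ϖ χ z t = ∑ k ∈ Finset.range M, z ^ k * layer ϖ χ k t +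
      (ball M 0).indicator (quasiChar ϖ χ z) t := by
  induction M with
  | zero => simp [ball_zero]
  | succ M ih =>
    rw [ih, Finset.sum_range_succ, add_assoc]
    congr 1
    have hsub : ball (M + 1) (0 : R) ⊆ ball M 0 := ball_antitone 0 M.le_succ
    by_cases hM : t ∈ ball M 0 \ ball (M + 1) 0
    · rw [Set.indicator_of_mem hM.1, Set.indicator_of_notMem hM.2, add_zero,
        quasiChar_eq_pow_mul_layer hϖ χ z hM]
    · rw [layer, Set.indicator_of_notMem hM, mul_zero, zero_add]
      by_cases hM' : t ∈ ball (M + 1) 0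
      · rw [Set.indicator_of_mem hM', Set.indicator_of_mem (hsub hM')]
      · rw [Set.indicator_of_notMem hM', Set.indicator_of_notMem fun h => hM ⟨h, hM'⟩]

end Algebra

section Topology

variable [TopologicalSpace R] [IsTopologicalRing R] [CompactSpace R] [T2Space R]
  {χ : Rˣ →* ℂˣ} (hχ : Continuous χ)
include hχ

lemma norm_quasiChar_le {z : ℂ} (hz : ‖z‖ < 1) {n : ℕ} {t : R} (ht : t ∈ ball n 0) :
    ‖quasiChar ϖ χ z t‖ ≤ ‖z‖ ^ n := by
  rcases eq_or_ne t 0 with rfl | h0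
  · rw [quasiChar_zero hϖ, norm_zero]; positivity
  obtain ⟨k, u, rfl⟩ := IsDiscreteValuationRing.eq_unit_mul_pow_irreducible h0 hϖ
  rw [mem_ball_zero_iff_dvd hϖ, u.isUnit.dvd_mul_left,
    pow_dvd_pow_iff hϖ.ne_zero hϖ.not_isUnit] at ht
  rw [quasiChar_unit_mul_pow hϖ, norm_mul, norm_eq_one_of_continuous hχ, one_mul, norm_pow]
  exact pow_le_pow_of_le_one (norm_nonneg _) hz.le ht

lemma continuousAt_quasiChar_of_ne_zero (z : ℂ) {t : R} (ht : t ≠ 0) :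
    ContinuousAt (quasiChar ϖ χ z) t := by
  obtain ⟨c, hc⟩ := exists_conductor hχ
  have hopen : IsOpen {x : R | ϖ ^ (c + 1) * t ∣ x - t} := by
    have hspan : IsOpen (Ideal.span {ϖ ^ (c + 1) * t} : Set R) :=
      IsDiscreteValuationRing.isOpen_iff.mpr (by simp [hϖ.ne_zero, ht])
    simpa [Set.preimage, Ideal.mem_span_singleton] using
      hspan.preimage (continuous_id.sub (continuous_const (y := t)))
  refine (continuousAt_const (y := quasiChar ϖ χ z t)).congr ?_
  filter_upwards [hopen.mem_nhds (by simp)] with x ⟨a, ha⟩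
  obtain ⟨v, hv⟩ : IsUnit (1 + ϖ ^ (c + 1) * a) :=
    isUnit_of_dvd_sub hϖ (y := 1) (by simp [pow_succ', mul_assoc]) isUnit_one
  have hx : x = t * v := by rw [hv]; linear_combination ha
  have hvc : χ v = 1 := hc v ((mem_maximalIdeal_pow_iff hϖ).mpr
    ⟨ϖ * a, by rw [hv]; ring⟩)
  rw [hx, quasiChar_mul hϖ, quasiChar_unit hϖ, hvc, Units.val_one, mul_one]

lemma continuous_quasiChar {z : ℂ} (hz : ‖z‖ < 1) : Continuous (quasiChar ϖ χ z) := by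
  refine continuous_iff_continuousAt.mpr fun t => ?_
  rcases eq_or_ne t 0 with rfl | ht
  · rw [ContinuousAt, quasiChar_zero hϖ]
    refine ((nhds_hasBasis_ball 0).tendsto_iff Metric.nhds_basis_closedBall).mpr fun ε hε => ?_
    obtain ⟨n, hn⟩ := exists_pow_lt_of_lt_one hε hz
    refine ⟨n, trivial, fun x hx => ?_⟩
    rw [mem_closedBall_zero_iff]
    exact (norm_quasiChar_le hϖ hχ hz hx).trans hn.le
  · exact continuousAt_quasiChar_of_ne_zero hϖ hχ z ht

lemma continuous_layer (k : ℕ) : Continuous (layer ϖ χ k) := by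
  have hclopen := (isClopen_ball k (0 : R)).diff (isClopen_ball (k + 1) 0)
  refine continuous_indicator (by simp [hclopen.frontier_eq]) fun t ht => ?_
  rw [hclopen.1.closure_eq] at ht
  refine (continuousAt_quasiChar_of_ne_zero hϖ hχ 1 ?_).continuousWithinAt
  rintro rfl
  exact ht.2 (mem_ball_self _ 0)

end Topology

section Integral

variable [TopologicalSpace R] [IsTopologicalRing R] [CompactSpace R] [T2Space R]
  [MeasurableSpace R] [BorelSpace R] (μ : Measure R) [μ.IsAddHaarMeasure] [IsProbabilityMeasure μ]

lemma setIntegral_quasiChar_ball_zero (χ : Rˣ →* ℂˣ) (z : ℂ) (n : ℕ) :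
    ∫ t in ball n 0, quasiChar ϖ χ z t ∂μ =
      ((Nat.card (ResidueField R) : ℂ)⁻¹) ^ n * (z ^ n * ∫ t, quasiChar ϖ χ z t ∂μ) := by
  simp_rw [setIntegral_ball_zero μ hϖ, quasiChar_pow_mul hϖ, integral_const_mul]

lemma integral_quasiChar {χ : Rˣ →* ℂˣ} (hχ : Continuous χ) {z : ℂ} (hz : ‖z‖ < 1) :
    ∫ t, quasiChar ϖ χ z t ∂μ = (∫ t, quasiChar ϖ χ 0 t ∂μ) /
      (1 - (Nat.card (ResidueField R) : ℂ)⁻¹ * z) := by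
  have hrec {w : ℂ} (hw : ‖w‖ < 1) : ∫ t, quasiChar ϖ χ w t ∂μ = ∫ t, layer ϖ χ 0 t ∂μ +
      (Nat.card (ResidueField R) : ℂ)⁻¹ * w * ∫ t, quasiChar ϖ χ w t ∂μ := by
    have hball := isClopen_ball 1 (0 : R)
    have hint := integrable_of_continuous μ (continuous_quasiChar hϖ hχ hw)
    calc ∫ t, quasiChar ϖ χ w t ∂μ
        = ∫ t, layer ϖ χ 0 t + (ball 1 0).indicator (quasiChar ϖ χ w) t ∂μ :=
          integral_congr_ae (.of_forall fun t => by
            simpa using quasiChar_eq_sum_layer_add hϖ χ w 1 t)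
      _ = _ := by
          rw [integral_add (integrable_of_continuous μ (continuous_layer hϖ hχ 0))
            (hint.indicator hball.2.measurableSet), integral_indicator hball.2.measurableSet,
            setIntegral_quasiChar_ball_zero hϖ]
          ring
  have h0 : ∫ t, quasiChar ϖ χ 0 t ∂μ = ∫ t, layer ϖ χ 0 t ∂μ := by
    simpa using hrec (w := 0) (by simp)
  rw [eq_div_iff (one_sub_natCast_inv_mul_ne_zero _ hz), h0]
  linear_combination hrec hz

end Integral

end QuasiChar

section PowerMap

variable {R : Type*} [CommRing R] [IsDomain R] [IsDiscreteValuationRing R] {ϖ : R}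
  (hϖ : Irreducible ϖ)
include hϖ

lemma dvd_or_irreducible_mul_dvd (x y : R) : x ∣ y ∨ ϖ * y ∣ x := by
  rcases ValuationRing.dvd_total x y with h | ⟨c, rfl⟩
  · exact .inl h
  · refine (isUnit_or_dvd hϖ c).imp (fun hc => hc.mul_right_dvd.mpr dvd_rfl) fun hc => ?_
    rw [mul_comm]
    exact mul_dvd_mul_left y hc

lemma isUnit_one_add_mul (x : R) : IsUnit (1 + ϖ * x) :=
  isUnit_of_dvd_sub hϖ (by simp) isUnit_one

lemma quasiChar_one_add_mul_eq_one (χ : Rˣ →* ℂˣ) (z : ℂ) {I : Ideal R}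
    (hχ : ∀ u : Rˣ, (u : R) - 1 ∈ I → χ u = 1) {x : R} (hx : ϖ * x ∈ I) :
    quasiChar ϖ χ z (1 + ϖ * x) = 1 := by
  obtain ⟨u, hu⟩ := isUnit_one_add_mul hϖ x
  rw [← hu, quasiChar_unit hϖ, hχ u (by simpa [hu] using hx), Units.val_one]

lemma associated_of_mul_dvd_sub {x y : R} (h : ϖ * x ∣ y - x) : Associated x y := by
  obtain ⟨c, hc⟩ := h
  obtain ⟨u, hu⟩ := isUnit_one_add_mul hϖ c
  exact ⟨u, by rw [hu]; linear_combination -hc⟩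

lemma associated_pow_sub_pow {m : ℕ} (hm : IsUnit (m : R)) {x y : R} (h : ϖ * x ∣ y - x) :
    Associated (x ^ m - y ^ m) (x ^ (m - 1) * (x - y)) := by
  obtain ⟨c, hc⟩ := h
  have hm0 : m ≠ 0 := by rintro rfl; simp at hm
  have hmod : ϖ ∣ ∑ i ∈ Finset.range m, (1 + ϖ * c) ^ i - m := by
    have hterm (i : ℕ) : ϖ ∣ (1 + ϖ * c) ^ i - 1 := by
      simpa using (dvd_mul_right ϖ c).trans (by simpa using sub_dvd_pow_sub_pow (1 + ϖ * c) 1 i)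
    simpa [Finset.sum_sub_distrib] using
      Finset.dvd_sum (s := Finset.range m) fun i _ => hterm i
  obtain ⟨u, hu⟩ := isUnit_of_dvd_sub hϖ hmod hm
  refine .symm ⟨u, ?_⟩
  have hy : y = x * (1 + ϖ * c) := by linear_combination hc
  rw [hu, hy, mul_pow, ← pow_sub_one_mul hm0 x]
  linear_combination x ^ (m - 1) * x * mul_neg_geom_sum (1 + ϖ * c) m

lemma associated_mul_sub_mul {ρ : R → R} (hρ : ∀ x, ϖ ∣ ρ x - 1)
    (hclose : ∀ x y, ϖ * x ∣ y - x → Associated (x * ρ x - y * ρ y) (x - y)) (x y : R) :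
    Associated (x * ρ x - y * ρ y) (x - y) := by
  rcases dvd_or_irreducible_mul_dvd hϖ (x - y) x with ⟨c, hc⟩ | h
  · obtain ⟨e, he⟩ := hρ x
    obtain ⟨f, hf⟩ := hρ y
    obtain ⟨u, hu⟩ := isUnit_one_add_mul hϖ (c * (e - f) + f)
    refine .symm ⟨u, ?_⟩
    rw [hu]
    linear_combination -x * he + y * hf - ϖ * (e - f) * hc
  · exact hclose x y (dvd_sub_comm.mp h)

variable [TopologicalSpace R] [IsTopologicalRing R] [CompactSpace R] [T2Space R]

lemma exists_pow_eq_of_dvd_sub_one {m : ℕ} (hm : IsUnit (m : R)) {a : R} (ha : ϖ ∣ a - 1) :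
    ∃ r : R, ϖ ∣ r - 1 ∧ r ^ m = a := by
  have hdvd (x : R) : ϖ ∣ (1 + ϖ * x) ^ m - 1 :=
    (dvd_mul_right ϖ x).trans (by simpa using sub_dvd_pow_sub_pow (1 + ϖ * x) 1 m)
  choose φ hφ using hdvd
  have hassoc (x y : R) : Associated (φ x - φ y) (x - y) := by
    obtain ⟨u, hu⟩ := isUnit_one_add_mul hϖ x
    have hpow := associated_pow_sub_pow hϖ hm (x := 1 + ϖ * x) (y := 1 + ϖ * y)
      (by rw [← hu, Units.mul_right_dvd]; exact ⟨y - x, by rw [hu]; ring⟩)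
    have hl : (1 + ϖ * x) ^ m - (1 + ϖ * y) ^ m = ϖ * (φ x - φ y) := by
      linear_combination hφ x - hφ y
    have hr : 1 + ϖ * x - (1 + ϖ * y) = ϖ * (x - y) := by ring
    rw [hl, hr, ← hu, ← Units.val_pow_eq_pow_val,
      associated_isUnit_mul_right_iff (u ^ (m - 1)).isUnit] at hpow
    exact hpow.of_mul_left .rfl hϖ.ne_zero
  obtain ⟨c, hc⟩ := ha
  obtain ⟨x, hx⟩ := surjective_of_sub_mem_iff
    (fun n x y => (maximalIdeal R ^ n).mem_iff_of_associated (hassoc x y)) c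
  exact ⟨1 + ϖ * x, by simp, by linear_combination hφ x + ϖ * hx - hc⟩

lemma exists_mul_pow_eq_add {m : ℕ} (hm : IsUnit (m : R)) {b y τ : R} {M : ℕ}
    (hτ : τ ∈ ball M 0) (hy : b * y ^ m ∉ ball M 0) :
    ∃ ρ : R, ϖ ∣ ρ - 1 ∧ b * (y * ρ) ^ m = b * y ^ m + τ := by
  rw [mem_ball_zero_iff_dvd hϖ] at hτ hy
  obtain ⟨c, rfl⟩ := ((dvd_or_irreducible_mul_dvd hϖ _ _).resolve_left hy).trans hτ
  obtain ⟨ρ, hρ, hpow⟩ := exists_pow_eq_of_dvd_sub_one hϖ hm (a := 1 + ϖ * c) (by simp)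
  exact ⟨ρ, hρ, by rw [mul_pow, hpow]; ring⟩

lemma exists_isometry_mul_pow_eq_add {m : ℕ} (hm : IsUnit (m : R)) {b τ : R} (hb : b ≠ 0) {M : ℕ}
    (hτ : τ ∈ ball M 0) :
    ∃ T : R → R, (∀ x y, Associated (T x - T y) (x - y)) ∧ (∀ y, Associated (T y) y) ∧
      ∀ y, b * y ^ m ∉ ball M 0 → b * T y ^ m = b * y ^ m + τ := by
  have hexists (y : R) : ∃ ρ : R, ϖ ∣ ρ - 1 ∧ (b * y ^ m ∈ ball M 0 → ρ = 1) ∧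
      (b * y ^ m ∉ ball M 0 → b * (y * ρ) ^ m = b * y ^ m + τ) := by
    by_cases hy : b * y ^ m ∈ ball M 0
    · exact ⟨1, by simp [hy]⟩
    · obtain ⟨ρ, hρ, hpow⟩ := exists_mul_pow_eq_add hϖ hm hτ hy
      exact ⟨ρ, hρ, (absurd · hy), fun _ => hpow⟩
  choose ρ hρ hρ_one hρ_pow using hexists
  have hself (y : R) : Associated (y * ρ y) y :=
    associated_mul_unit_left y _ (isUnit_of_dvd_sub hϖ (hρ y) isUnit_one)
  refine ⟨fun y => y * ρ y, associated_mul_sub_mul hϖ hρ fun x y hxy => ?_, hself, hρ_pow⟩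
  have hiff : b * x ^ m ∈ ball M 0 ↔ b * y ^ m ∈ ball M 0 :=
    mem_ball_zero_iff_of_associated ((associated_of_mul_dvd_sub hϖ hxy).pow_pow.mul_left b)
  by_cases hx : b * x ^ m ∈ ball M 0
  · simp only [hρ_one x hx, hρ_one y (hiff.mp hx), mul_one]
    rfl
  have hx0 : x ≠ 0 := by
    rintro rfl
    have hm0 : m ≠ 0 := by rintro rfl; simp at hm
    simp [hm0, mem_ball] at hx
  have hpow : (x * ρ x) ^ m - (y * ρ y) ^ m = x ^ m - y ^ m :=
    mul_left_cancel₀ hb (by linear_combination hρ_pow x hx - hρ_pow y (mt hiff.mpr hx))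
  have hclose : ϖ * (x * ρ x) ∣ y * ρ y - x * ρ x := by
    rw [((hself x).mul_left ϖ).dvd_iff_dvd_left]
    have hsplit : y * ρ y - x * ρ x = (y - x) * ρ y + x * ((ρ y - 1) - (ρ x - 1)) := by ring
    rw [hsplit]
    exact dvd_add (hxy.mul_right (ρ y))
      (mul_comm x ϖ ▸ mul_dvd_mul_left x (dvd_sub (hρ y) (hρ x)))
  have hassoc := (associated_pow_sub_pow hϖ hm hclose).symm.trans
    (hpow ▸ associated_pow_sub_pow hϖ hm hxy)
  exact hassoc.of_mul_left (hself x).pow_pow (pow_ne_zero _ (mul_ne_zero hx0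
    (isUnit_of_dvd_sub hϖ (hρ x) isUnit_one).ne_zero))

end PowerMap

section Equidistribution

variable {X : Type*} [TopologicalSpace X] [CompactSpace X] [MeasurableSpace X]
  [OpensMeasurableSpace X] (ν : Measure X) [IsFiniteMeasure ν]

lemma setIntegral_add_left {G : Type*} [AddGroup G] [MeasurableSpace G] [MeasurableAdd G]
    (μ : Measure G) [μ.IsAddLeftInvariant] (E : AddSubgroup G) {F : G → ℂ}
    (hF : Function.support F ⊆ E) (g : G) :
    ∫ τ in E, F (g + τ) ∂μ = (E : Set G).indicator (fun _ => ∫ t, F t ∂μ) g := by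
  by_cases hg : g ∈ E
  · rw [Set.indicator_of_mem (show g ∈ (E : Set G) from hg),
      setIntegral_eq_integral_of_forall_compl_eq_zero, integral_add_left_eq_self]
    exact fun τ hτ => Function.notMem_support.mp fun h => hτ ((E.add_mem_cancel_left hg).mp (hF h))
  · rw [Set.indicator_of_notMem (show g ∉ (E : Set G) from hg)]
    exact setIntegral_eq_zero_of_forall_eq_zero fun τ hτ => Function.notMem_support.mp
      fun h => hg ((E.add_mem_cancel_right hτ).mp (hF h))

-- Invariance under translation of the values of `h` by `E` makes them equidistributed in `E`.
lemma measureReal_mul_integral_mul_comp {G : Type*} [AddGroup G] [TopologicalSpace G]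
    [IsTopologicalAddGroup G] [CompactSpace G] [SecondCountableTopology G] [MeasurableSpace G]
    [BorelSpace G] (μ : Measure G) [μ.IsAddHaarMeasure] {E : AddSubgroup G}
    (hE : MeasurableSet (E : Set G)) {h : X → G} (hh : Continuous h) {Ψ : X → ℂ}
    (hΨ : Continuous Ψ) {F : G → ℂ} (hF : Continuous F) (hsupp : Function.support F ⊆ E)
    (hshift : ∀ τ ∈ E, ∫ x, Ψ x * F (h x + τ) ∂ν = ∫ x, Ψ x * F (h x) ∂ν) :
    μ.real E * ∫ x, Ψ x * F (h x) ∂ν = (∫ x in h ⁻¹' E, Ψ x ∂ν) * ∫ t, F t ∂μ := by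
  have hint : Integrable (Function.uncurry fun τ x => Ψ x * F (h x + τ))
      ((μ.restrict E).prod ν) :=
    integrable_of_continuous _ ((hΨ.comp continuous_snd).mul
      (hF.comp ((hh.comp continuous_snd).add continuous_fst)))
  calc μ.real E * ∫ x, Ψ x * F (h x) ∂ν
      = ∫ τ in E, ∫ x, Ψ x * F (h x + τ) ∂ν ∂μ := by
        rw [setIntegral_congr_fun hE hshift, setIntegral_const, Complex.real_smul]
    _ = ∫ x, ∫ τ in E, Ψ x * F (h x + τ) ∂μ ∂ν := integral_integral_swap hint
    _ = ∫ x, (h ⁻¹' E).indicator Ψ x * ∫ t, F t ∂μ ∂ν := by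
        refine integral_congr_ae (.of_forall fun x => ?_)
        dsimp only
        rw [integral_const_mul, setIntegral_add_left μ E hsupp]
        by_cases hx : h x ∈ E <;> simp [hx]
    _ = (∫ x in h ⁻¹' E, Ψ x ∂ν) * ∫ t, F t ∂μ := by
        rw [integral_mul_const, integral_indicator (hh.measurable hE)]

variable {R : Type*} [CommRing R] [IsDomain R] [IsDiscreteValuationRing R] [TopologicalSpace R]
  [IsTopologicalRing R] [CompactSpace R] [T2Space R] [MeasurableSpace R] [BorelSpace R]
  (μ : Measure R) [μ.IsAddHaarMeasure] [IsProbabilityMeasure μ] {ϖ : R} (hϖ : Irreducible ϖ)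
  {χ : Rˣ →* ℂˣ} (hχ : Continuous χ)
include μ hϖ hχ

lemma integral_mul_indicator_quasiChar_comp {h : X → R} (hh : Continuous h) {Ψ : X → ℂ}
    (hΨ : Continuous Ψ) {M : ℕ}
    (hshift : ∀ τ ∈ ball M 0, ∀ F : R → ℂ, Continuous F → Function.support F ⊆ ball M 0 →
      ∫ x, Ψ x * F (h x + τ) ∂ν = ∫ x, Ψ x * F (h x) ∂ν) {z : ℂ} (hz : ‖z‖ < 1) :
    ∫ x, Ψ x * (ball M 0).indicator (quasiChar ϖ χ z) (h x) ∂ν =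
      z ^ M * (∫ x in h ⁻¹' ball M 0, Ψ x ∂ν) * ∫ t, quasiChar ϖ χ z t ∂μ := by
  have hclopen := isClopen_ball M (0 : R)
  have hF : Continuous ((ball M 0).indicator (quasiChar ϖ χ z)) :=
    (continuous_quasiChar hϖ hχ hz).indicator (by simp [hclopen.frontier_eq])
  have hq : (Nat.card (ResidueField R) : ℂ)⁻¹ ^ M ≠ 0 :=
    pow_ne_zero M (inv_ne_zero (Nat.cast_ne_zero.mpr Nat.card_pos.ne'))
  have hcoe : ((maximalIdeal R ^ M).toAddSubgroup : Set R) = ball M 0 := (ball_zero M).symm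
  have hmain := measureReal_mul_integral_mul_comp ν μ (E := (maximalIdeal R ^ M).toAddSubgroup)
    (hcoe ▸ hclopen.2.measurableSet) hh hΨ hF (hcoe ▸ Set.support_indicator_subset)
    fun τ hτ => hshift τ (hcoe ▸ hτ) _ hF Set.support_indicator_subset
  rw [hcoe, measureReal_ball_zero, integral_indicator hclopen.2.measurableSet,
    setIntegral_quasiChar_ball_zero hϖ] at hmain
  push_cast at hmain
  exact mul_left_cancel₀ hq (hmain.trans (by ring))

lemma exists_polynomial_integral_mul_quasiChar_comp {h : X → R} (hh : Continuous h) {Ψ : X → ℂ}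
    (hΨ : Continuous Ψ) {M : ℕ}
    (hshift : ∀ τ ∈ ball M 0, ∀ F : R → ℂ, Continuous F → Function.support F ⊆ ball M 0 →
      ∫ x, Ψ x * F (h x + τ) ∂ν = ∫ x, Ψ x * F (h x) ∂ν) :
    ∃ P : Polynomial ℂ, ∀ z : ℂ, ‖z‖ < 1 → ∫ x, Ψ x * quasiChar ϖ χ z (h x) ∂ν =
      P.eval z / (1 - (Nat.card (ResidueField R) : ℂ)⁻¹ * z) := by
  let q := Nat.card (ResidueField R)
  refine ⟨(∑ k ∈ Finset.range M, .X ^ k * .C (∫ x, Ψ x * layer ϖ χ k (h x) ∂ν)) *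
    (1 - .C (q : ℂ)⁻¹ * .X) +
    .X ^ M * .C ((∫ x in h ⁻¹' ball M 0, Ψ x ∂ν) * ∫ t, quasiChar ϖ χ 0 t ∂μ), fun z hz => ?_⟩
  have hint_layer : ∀ k ∈ Finset.range M,
      Integrable (fun x => z ^ k * (Ψ x * layer ϖ χ k (h x))) ν := fun k _ =>
    integrable_of_continuous ν
      (continuous_const.mul (hΨ.mul ((continuous_layer hϖ hχ k).comp hh)))
  have hint_tail : Integrable (fun x => Ψ x * (ball M 0).indicator (quasiChar ϖ χ z) (h x)) ν :=
    integrable_of_continuous ν (hΨ.mul (((continuous_quasiChar hϖ hχ hz).indicator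
      (by simp [(isClopen_ball M (0 : R)).frontier_eq])).comp hh))
  have hden := one_sub_natCast_inv_mul_ne_zero q hz
  calc ∫ x, Ψ x * quasiChar ϖ χ z (h x) ∂ν
      = ∫ x, ∑ k ∈ Finset.range M, z ^ k * (Ψ x * layer ϖ χ k (h x)) +
          Ψ x * (ball M 0).indicator (quasiChar ϖ χ z) (h x) ∂ν := by
        refine integral_congr_ae (.of_forall fun x => ?_)
        dsimp only
        rw [quasiChar_eq_sum_layer_add hϖ χ z M, mul_add, Finset.mul_sum]
        simp only [mul_left_comm]
    _ = ∑ k ∈ Finset.range M, z ^ k * ∫ x, Ψ x * layer ϖ χ k (h x) ∂ν +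
          z ^ M * (∫ x in h ⁻¹' ball M 0, Ψ x ∂ν) * ∫ t, quasiChar ϖ χ z t ∂μ := by
        rw [integral_add (integrable_finsetSum _ hint_layer) hint_tail,
          integral_finsetSum _ hint_layer,
          integral_mul_indicator_quasiChar_comp ν μ hϖ hχ hh hΨ hshift hz]
        simp only [integral_const_mul]
    _ = _ := by
        rw [integral_quasiChar hϖ μ hχ hz]
        simp only [Polynomial.eval_add, Polynomial.eval_mul, Polynomial.eval_finsetSum,
          Polynomial.eval_C, Polynomial.eval_X, Polynomial.eval_pow, Polynomial.eval_sub,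
          Polynomial.eval_one]
        rw [add_div, mul_div_cancel_right₀ _ hden]
        ring

end Equidistribution

section Binomial

variable {R : Type*} [CommRing R] [IsDomain R] [IsDiscreteValuationRing R] {ϖ : R}
  (hϖ : Irreducible ϖ)
include hϖ

-- Outside `ϖ ^ a R × ϖ ^ b R`, the two summands cannot both be small.
lemma exists_forall_mul_pow_notMem_ball {μ₁ μ₂ : R} (hμ₁ : IsUnit μ₁) (hμ₂ : μ₂ ≠ 0)
    {d m a b : ℕ} (hd : d ≠ 0) (hm : m ≠ 0) (hab : d * a = m * b) :
    ∃ M : ℕ, ∀ x y : R, (x, y) ∉ ball a 0 ×ˢ ball b 0 → μ₁ * x ^ d + μ₂ * y ^ m ∈ ball M 0 →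
      μ₂ * y ^ m ∉ ball M 0 := by
  obtain ⟨k, u, rfl⟩ := IsDiscreteValuationRing.eq_unit_mul_pow_irreducible hμ₂ hϖ
  refine ⟨k + d * a, fun x y hxy hsum hy => hxy ⟨?_, ?_⟩⟩
  · have hx : ϖ ^ (k + d * a) ∣ x ^ d := hμ₁.dvd_mul_left.mp
      ((mem_ball_zero_iff_dvd hϖ).mp ((add_mem_ball_zero_iff hy).mp hsum))
    rw [mem_ball_zero_iff_dvd hϖ, ← IsIntegrallyClosed.pow_dvd_pow_iff hd, ← pow_mul, mul_comm a]
    exact (pow_dvd_pow ϖ (Nat.le_add_left _ _)).trans hx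
  · rw [mem_ball_zero_iff_dvd hϖ, mul_assoc, Units.dvd_mul_left, pow_add,
      mul_dvd_mul_iff_left (pow_ne_zero k hϖ.ne_zero), hab, mul_comm m, pow_mul] at hy
    exact (mem_ball_zero_iff_dvd hϖ).mpr ((IsIntegrallyClosed.pow_dvd_pow_iff hm).mp hy)

lemma quasiChar_binomial_smul (χ : Rˣ →* ℂˣ) (z : ℂ) (μ₁ μ₂ x y : R)
    {d m a b : ℕ} (hab : d * a = m * b) :
    quasiChar ϖ χ z (μ₁ * (ϖ ^ a * x) ^ d + μ₂ * (ϖ ^ b * y) ^ m) =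
      z ^ (d * a) * quasiChar ϖ χ z (μ₁ * x ^ d + μ₂ * y ^ m) := by
  rw [← quasiChar_pow_mul hϖ]
  congr 1
  rw [mul_pow, mul_pow, ← pow_mul, ← pow_mul, mul_comm a, mul_comm b, ← hab]
  ring

variable [TopologicalSpace R] [IsTopologicalRing R] [CompactSpace R] [T2Space R]
  [MeasurableSpace R] [BorelSpace R] (μ : Measure R) [μ.IsAddHaarMeasure]

lemma integral_mul_comp_add_mul_pow_add {m : ℕ} (hm : IsUnit (m : R)) {b : R} (hb : b ≠ 0)
    {w : R → R} (hw : Continuous w) {Ψ : R × R → ℂ} (hΨ : Continuous Ψ)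
    (hΨ_assoc : ∀ x y y', Associated y y' → Ψ (x, y) = Ψ (x, y')) {M : ℕ}
    (hΨM : ∀ x y, Ψ (x, y) ≠ 0 → w x + b * y ^ m ∈ ball M 0 → b * y ^ m ∉ ball M 0)
    {τ : R} (hτ : τ ∈ ball M 0) {F : R → ℂ} (hF : Continuous F)
    (hsupp : Function.support F ⊆ ball M 0) :
    ∫ p, Ψ p * F (w p.1 + b * p.2 ^ m + τ) ∂μ.prod μ =
      ∫ p, Ψ p * F (w p.1 + b * p.2 ^ m) ∂μ.prod μ := by
  obtain ⟨T, hT_sub, hT_self, hT_pow⟩ := exists_isometry_mul_pow_eq_add hϖ hm hb hτ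
  have hT := (MeasurePreserving.id μ).prod (measurePreserving_of_sub_mem_iff
    (fun n x y => (maximalIdeal R ^ n).mem_iff_of_associated (hT_sub x y)) μ)
  have hcont : Continuous fun p : R × R => Ψ p * F (w p.1 + b * p.2 ^ m) := by fun_prop
  rw [← hT.map_eq, integral_map hT.measurable.aemeasurable hcont.aestronglyMeasurable, hT.map_eq]
  refine integral_congr_ae (.of_forall fun ⟨x, y⟩ => ?_)
  simp only [Prod.map_apply, id_eq, hΨ_assoc x _ _ (hT_self y)]
  by_cases hΨ0 : Ψ (x, y) = 0
  · rw [hΨ0, zero_mul, zero_mul]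
  congr 1
  by_cases hy : b * y ^ m ∈ ball M 0
  · have hTy : b * T y ^ m ∈ ball M 0 := by
      rw [mem_ball_zero_iff_dvd hϖ] at hy ⊢
      exact (((hT_self y).pow_pow).mul_left b).dvd_iff_dvd_right.mpr hy
    have hx : w x + b * y ^ m ∉ ball M 0 := fun h => hΨM x y hΨ0 h hy
    have hFzero {t : R} (ht : t ∉ ball M 0) : F t = 0 :=
      Function.notMem_support.mp (mt (@hsupp t) ht)
    rw [hFzero, hFzero]
    · rwa [add_mem_ball_zero_iff hTy, ← add_mem_ball_zero_iff hy]
    · rwa [add_mem_ball_zero_iff hτ]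
  · rw [hT_pow y hy, add_assoc]

variable {χ : Rˣ →* ℂˣ} (hχ : Continuous χ) [IsProbabilityMeasure μ]
include hχ

lemma exists_polynomial_integral_add_mul_pow {m : ℕ} (hm : IsUnit (m : R)) {b : R} (hb : b ≠ 0)
    {w : R → R} (hw : Continuous w) {Ψ : R × R → ℂ} (hΨ : Continuous Ψ)
    (hΨ_assoc : ∀ x y y', Associated y y' → Ψ (x, y) = Ψ (x, y')) {M : ℕ}
    (hΨM : ∀ x y, Ψ (x, y) ≠ 0 → w x + b * y ^ m ∈ ball M 0 → b * y ^ m ∉ ball M 0) :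
    ∃ P : Polynomial ℂ, ∀ z : ℂ, ‖z‖ < 1 →
      ∫ p, Ψ p * quasiChar ϖ χ z (w p.1 + b * p.2 ^ m) ∂μ.prod μ =
        P.eval z / (1 - (Nat.card (ResidueField R) : ℂ)⁻¹ * z) :=
  exists_polynomial_integral_mul_quasiChar_comp (μ.prod μ) μ hϖ hχ (by fun_prop) hΨ
    fun _ hτ _ hF hsupp =>
      integral_mul_comp_add_mul_pow_add hϖ μ hm hb hw hΨ hΨ_assoc hΨM hτ hF hsupp

lemma exists_polynomial_setIntegral_binomial {μ₁ μ₂ : R} (hμ₁ : IsUnit μ₁) (hμ₂ : μ₂ ≠ 0)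
    {d m a b : ℕ} (hd : d ≠ 0) (hm : IsUnit (m : R)) (hab : d * a = m * b) {ψ : R → ℂ}
    (hψ : Continuous ψ) :
    ∃ P : Polynomial ℂ, ∀ z : ℂ, ‖z‖ < 1 →
      ∫ p in (ball a 0 ×ˢ ball b 0)ᶜ,
        ψ p.1 * quasiChar ϖ χ z (μ₁ * p.1 ^ d + μ₂ * p.2 ^ m) ∂μ.prod μ =
        P.eval z / (1 - (Nat.card (ResidueField R) : ℂ)⁻¹ * z) := by
  have hm0 : m ≠ 0 := by rintro rfl; simp at hm
  obtain ⟨M, hM⟩ := exists_forall_mul_pow_notMem_ball hϖ hμ₁ hμ₂ hd hm0 hab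
  have hclopen : IsClopen (ball a 0 ×ˢ ball b 0 : Set (R × R))ᶜ :=
    ((isClopen_ball a 0).prod (isClopen_ball b 0)).compl
  have hΨ : Continuous ((ball a 0 ×ˢ ball b 0)ᶜ.indicator fun p : R × R => ψ p.1) :=
    (hψ.comp continuous_fst).indicator (by simp [hclopen.frontier_eq])
  obtain ⟨P, hP⟩ := exists_polynomial_integral_add_mul_pow hϖ μ hχ hm hμ₂
    (w := fun x => μ₁ * x ^ d) (by fun_prop) hΨ
    (fun x y y' hy => by
      classical
      simp only [Set.indicator_apply, Set.mem_compl_iff, Set.mem_prod,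
        mem_ball_zero_iff_of_associated hy])
    (fun x y hxy => hM x y (Set.mem_of_indicator_ne_zero hxy))
  refine ⟨P, fun z hz => ?_⟩
  rw [← hP z hz, ← integral_indicator hclopen.2.measurableSet]
  congr 1 with p
  exact Set.indicator_mul_left _ _ _

lemma exists_polynomial_integral_binomial_eq_add {μ₁ μ₂ : R} (hμ₁ : IsUnit μ₁) (hμ₂ : μ₂ ≠ 0)
    {d m a b : ℕ} (hd : d ≠ 0) (hm : IsUnit (m : R)) (hab : d * a = m * b) {ψ : R → ℂ}
    (hψ : Continuous ψ) :
    ∃ P : Polynomial ℂ, ∀ z : ℂ, ‖z‖ < 1 →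
      ∫ p, ψ p.1 * quasiChar ϖ χ z (μ₁ * p.1 ^ d + μ₂ * p.2 ^ m) ∂μ.prod μ =
        P.eval z / (1 - (Nat.card (ResidueField R) : ℂ)⁻¹ * z) +
        (Nat.card (ResidueField R) : ℂ)⁻¹ ^ (a + b) * z ^ (d * a) *
          ∫ p, ψ (ϖ ^ a * p.1) * quasiChar ϖ χ z (μ₁ * p.1 ^ d + μ₂ * p.2 ^ m) ∂μ.prod μ := by
  obtain ⟨P, hP⟩ := exists_polynomial_setIntegral_binomial hϖ μ hχ hμ₁ hμ₂ hd hm hab hψ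
  refine ⟨P, fun z hz => ?_⟩
  have hW := continuous_quasiChar hϖ hχ hz
  have hint : Integrable (fun p : R × R => ψ p.1 * quasiChar ϖ χ z (μ₁ * p.1 ^ d + μ₂ * p.2 ^ m))
      (μ.prod μ) := integrable_of_continuous _ (by fun_prop)
  have hmeas : MeasurableSet (ball a 0 ×ˢ ball b 0 : Set (R × R)) :=
    ((isClopen_ball a 0).prod (isClopen_ball b 0)).2.measurableSet
  rw [← integral_add_compl hmeas hint, hP z hz, setIntegral_ball_zero_prod μ hϖ,
    add_comm, mul_assoc]
  simp_rw [quasiChar_binomial_smul hϖ χ z μ₁ μ₂ _ _ hab, mul_left_comm (ψ _) (z ^ (d * a)),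
    integral_const_mul]

theorem exists_polynomial_integral_binomial {μ₁ μ₂ : R} (hμ₁ : IsUnit μ₁) (hμ₂ : μ₂ ≠ 0)
    {d m a b : ℕ} (hd : d ≠ 0) (hm : IsUnit (m : R)) (ha : a ≠ 0) (hab : d * a = m * b)
    {ψ : R → ℂ} (hψ : Continuous ψ) {c : ℕ} (hψ_one : ∀ x ∈ ball c 0, ψ x = 1) :
    ∃ P : Polynomial ℂ, ∀ z : ℂ, ‖z‖ < 1 →
      ∫ p, ψ p.1 * quasiChar ϖ χ z (μ₁ * p.1 ^ d + μ₂ * p.2 ^ m) ∂μ.prod μ =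
        P.eval z / ((1 - (Nat.card (ResidueField R) : ℂ)⁻¹ * z) *
          (1 - (Nat.card (ResidueField R) : ℂ)⁻¹ ^ (a + b) * z ^ (d * a))) := by
  obtain ⟨P₁, hP₁⟩ := exists_polynomial_integral_binomial_eq_add hϖ μ hχ hμ₁ hμ₂ hd hm hab
    (ψ := fun _ => 1) continuous_const
  obtain ⟨P₂, hP₂⟩ := exists_polynomial_integral_binomial_eq_add hϖ μ hχ hμ₁ hμ₂ hd hm
    (a := c * a) (b := c * b) (by linear_combination c * hab) hψ
  let q := Nat.card (ResidueField R)
  let Q : Polynomial ℂ := .C ((q : ℂ)⁻¹ ^ (a + b)) * .X ^ (d * a)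
  refine ⟨P₂ * (1 - Q) + Q ^ c * P₁, fun z hz => ?_⟩
  have hden := one_sub_natCast_inv_mul_ne_zero q hz
  have hQ : Q.eval z = (q : ℂ)⁻¹ ^ (a + b) * z ^ (d * a) := by simp [Q]
  have hdenQ : 1 - Q.eval z ≠ 0 := by
    rw [hQ, inv_pow, ← Nat.cast_pow]
    refine one_sub_natCast_inv_mul_ne_zero _ ?_
    rw [norm_pow]
    exact pow_lt_one₀ (norm_nonneg z) hz (mul_ne_zero hd ha)
  have hQc : (q : ℂ)⁻¹ ^ (c * a + c * b) * z ^ (d * (c * a)) = Q.eval z ^ c := by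
    rw [hQ, mul_pow, ← pow_mul, ← pow_mul]
    ring
  have hscaled (x : R) : ψ (ϖ ^ (c * a) * x) = 1 := hψ_one _ <| (mem_ball_zero_iff_dvd hϖ).mpr <|
    (pow_dvd_pow ϖ (Nat.le_mul_of_pos_right c (Nat.pos_of_ne_zero ha))).mul_right x
  have hone := hP₁ z hz
  have hmain := hP₂ z hz
  simp only [hscaled] at hmain
  rw [← hQ] at hone
  rw [hQc] at hmain
  rw [hmain, ← hQ, eq_div_iff (mul_ne_zero hden hdenQ)]
  simp only [Polynomial.eval_add, Polynomial.eval_mul, Polynomial.eval_sub, Polynomial.eval_one,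
    Polynomial.eval_pow]
  linear_combination (1 - Q.eval z) * div_mul_cancel₀ (P₂.eval z) hden +
    Q.eval z ^ c * div_mul_cancel₀ (P₁.eval z) hden +
    Q.eval z ^ c * (1 - (q : ℂ)⁻¹ * z) * hone

end Binomial

section Perturbation

variable {R : Type*} [CommRing R] [IsDomain R] [IsDiscreteValuationRing R] [TopologicalSpace R]
  [IsTopologicalRing R] [CompactSpace R] [T2Space R] [MeasurableSpace R] [BorelSpace R]
  {ϖ : R} (hϖ : Irreducible ϖ) (μ : Measure R) [μ.IsAddHaarMeasure]
include hϖ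

lemma integral_comp_mul_pow_mul_add {d : ℕ} (hd : IsUnit (d : R)) (g : Polynomial R) (a c : R)
    {F : R → ℂ} (hF : Continuous F) :
    ∫ x, F (a * x ^ d * (1 + ϖ * g.eval x) + c) ∂μ = ∫ x, F (a * x ^ d + c) ∂μ := by
  choose ρ hρ_one hρ_pow using fun x =>
    exists_pow_eq_of_dvd_sub_one hϖ hd (a := 1 + ϖ * g.eval x) (by simp)
  have hρ_unit (x : R) : IsUnit (ρ x) := isUnit_of_dvd_sub hϖ (hρ_one x) isUnit_one
  have hρ_sub (x y : R) : ϖ * (x - y) ∣ ρ x - ρ y := by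
    have hclose : ϖ * ρ x ∣ ρ y - ρ x := by
      rw [(hρ_unit x).mul_right_dvd, ← sub_sub_sub_cancel_right (ρ y) (ρ x) 1]
      exact dvd_sub (hρ_one y) (hρ_one x)
    have hassoc : Associated (ρ x ^ d - ρ y ^ d) (ρ x - ρ y) :=
      (associated_pow_sub_pow hϖ hd hclose).trans
        (associated_unit_mul_left _ _ ((hρ_unit x).pow _))
    rw [← hassoc.dvd_iff_dvd_right, hρ_pow, hρ_pow, add_sub_add_left_eq_sub, ← mul_sub]
    exact mul_dvd_mul_left ϖ (Polynomial.sub_dvd_eval_sub x y g)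
  have hG : Continuous fun x : R => F (a * x ^ d + c) := hF.comp (by fun_prop)
  rw [← integral_comp_of_associated_sub μ (φ := fun x => x * ρ x) (fun x y => ?_) hG]
  · simp only [mul_pow, hρ_pow, mul_assoc]
  · obtain ⟨f, hf⟩ := hρ_sub x y
    have hfactor : x * ρ x - y * ρ y = (ρ x + ϖ * (y * f)) * (x - y) := by
      linear_combination y * hf
    rw [hfactor]
    exact associated_unit_mul_left _ _ (isUnit_of_dvd_sub hϖ (by simp) (hρ_unit x))

variable {χ : Rˣ →* ℂˣ} (hχ : Continuous χ)
include hχ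

lemma integral_quasiChar_mul_add_mul_pow {m : ℕ} (hm : IsUnit (m : R)) {z : ℂ} (hz : ‖z‖ < 1)
    {v : R} (hv : ϖ ∣ v - 1) (a b : R) :
    ∫ y, quasiChar ϖ χ z (a * v + b * y ^ m) ∂μ =
      quasiChar ϖ χ 0 v * ∫ y, quasiChar ϖ χ z (a + b * y ^ m) ∂μ := by
  obtain ⟨r, hr, rfl⟩ := exists_pow_eq_of_dvd_sub_one hϖ hm hv
  obtain ⟨u, rfl⟩ := isUnit_of_dvd_sub hϖ hr isUnit_one
  have hF : Continuous fun y : R => quasiChar ϖ χ z (a * u ^ m + b * y ^ m) :=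
    (continuous_quasiChar hϖ hχ hz).comp (by fun_prop)
  have hassoc (x y : R) : Associated (u * x - u * y) (x - y) :=
    mul_sub (u : R) x y ▸ associated_unit_mul_left _ _ u.isUnit
  rw [← integral_comp_of_associated_sub μ (φ := fun y => u * y) hassoc hF, ← integral_const_mul]
  refine integral_congr_ae (.of_forall fun y => ?_)
  calc quasiChar ϖ χ z (a * u ^ m + b * (u * y) ^ m)
      = quasiChar ϖ χ z (((u ^ m : Rˣ) : R) * (a + b * y ^ m)) := by
        congr 1; push_cast; ring
    _ = quasiChar ϖ χ 0 (u ^ m) * quasiChar ϖ χ z (a + b * y ^ m) := by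
        rw [quasiChar_mul hϖ, ← Units.val_pow_eq_pow_val, quasiChar_unit hϖ, quasiChar_unit hϖ]

lemma integral_prod_quasiChar_mul_add_mul_pow {m : ℕ} (hm : IsUnit (m : R)) {z : ℂ}
    (hz : ‖z‖ < 1) {a v : R → R} (ha : Continuous a) (hv : Continuous v)
    (hv_one : ∀ x, ϖ ∣ v x - 1) (b : R) :
    ∫ p, quasiChar ϖ χ z (a p.1 * v p.1 + b * p.2 ^ m) ∂μ.prod μ =
      ∫ p, quasiChar ϖ χ 0 (v p.1) * quasiChar ϖ χ z (a p.1 + b * p.2 ^ m) ∂μ.prod μ := by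
  have hW := continuous_quasiChar hϖ hχ hz
  have hW₀ := continuous_quasiChar hϖ hχ (z := 0) (by simp)
  rw [integral_prod _ (integrable_of_continuous _ (by fun_prop)),
    integral_prod _ (integrable_of_continuous _ (by fun_prop))]
  simp only [integral_const_mul,
    integral_quasiChar_mul_add_mul_pow hϖ μ hχ hm hz (hv_one _)]

lemma integral_prod_quasiChar_mul_pow_mul_add {d : ℕ} (hd : IsUnit (d : R)) (g : Polynomial R)
    (a : R) {w : R → R} (hw : Continuous w) {z : ℂ} (hz : ‖z‖ < 1) :
    ∫ p, quasiChar ϖ χ z (a * p.1 ^ d * (1 + ϖ * g.eval p.1) + w p.2) ∂μ.prod μ =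
      ∫ p, quasiChar ϖ χ z (a * p.1 ^ d + w p.2) ∂μ.prod μ := by
  have hW := continuous_quasiChar hϖ hχ hz
  have := g.continuous
  rw [integral_prod_symm _ (integrable_of_continuous _ (by fun_prop)),
    integral_prod_symm _ (integrable_of_continuous _ (by fun_prop))]
  simp only [integral_comp_mul_pow_mul_add hϖ μ hd g a _ hW]

variable [IsProbabilityMeasure μ]

lemma integral_prod_quasiChar_mul_add {a : R} (ha : IsUnit a) {w : R → R} (hw : Continuous w)
    {z : ℂ} (hz : ‖z‖ < 1) :
    ∫ p, quasiChar ϖ χ z (a * p.1 + w p.2) ∂μ.prod μ = ∫ t, quasiChar ϖ χ z t ∂μ := by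
  have hW := continuous_quasiChar hϖ hχ hz
  have hassoc (c x y : R) : Associated ((a * x + c) - (a * y + c)) (x - y) := by
    rw [add_sub_add_right_eq_sub, ← mul_sub]
    exact associated_unit_mul_left _ _ ha
  rw [integral_prod_symm _ (integrable_of_continuous _ (by fun_prop))]
  simp [integral_comp_of_associated_sub μ (hassoc _) hW]

lemma exists_polynomial_integral_isUnit_add_mul_pow {m : ℕ} (hm : IsUnit (m : R)) {b : R}
    (hb : b ≠ 0) {w : R → R} (hw : Continuous w) (hw_unit : ∀ x, IsUnit (w x)) :
    ∃ P : Polynomial ℂ, ∀ z : ℂ, ‖z‖ < 1 →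
      ∫ p, quasiChar ϖ χ z (w p.1 + b * p.2 ^ m) ∂μ.prod μ =
        P.eval z / (1 - (Nat.card (ResidueField R) : ℂ)⁻¹ * z) := by
  have hnot (x y : R) (hsum : w x + b * y ^ m ∈ ball 1 0) : b * y ^ m ∉ ball 1 0 := fun hy => by
    rw [add_mem_ball_zero_iff hy, mem_ball_zero_iff_dvd hϖ, pow_one] at hsum
    exact hϖ.not_isUnit (isUnit_of_dvd_unit hsum (hw_unit x))
  simpa using exists_polynomial_integral_add_mul_pow hϖ μ hχ hm hb hw (Ψ := fun _ => 1)
    continuous_const (fun _ _ _ _ => rfl) fun x y _ => hnot x y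

end Perturbation

section Polynomial

variable {K : Type*} [Field K] [ValuativeRel K]

lemma isUnit_natCast_of_not_dvd {p : ℕ} (hp : p.Prime) [CharP K p] {n : ℕ} (hn : ¬ p ∣ n) :
    IsUnit (n : 𝒪[K]) := by
  have : CharP 𝒪[K] p := (algebraMap 𝒪[K] K).charP Subtype.val_injective p
  exact (CharP.isUnit_natCast_iff hp).mpr hn

lemma eval_hPoly (ϖ μ₁ μ₂ : 𝒪[K]) (d m : ℕ) (h₀ : Polynomial 𝒪[K]) (x y : 𝒪[K]) :
    MvPolynomial.eval ![x, y] (hPoly ϖ μ₁ μ₂ d m h₀) =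
      μ₁ * x ^ d + μ₂ * y ^ m + ϖ * h₀.eval x := by
  have h : MvPolynomial.eval ![x, y]
      (Polynomial.aeval (MvPolynomial.X 0 : MvPolynomial (Fin 2) 𝒪[K]) h₀) = h₀.eval x := by
    simpa [MvPolynomial.aeval_eq_eval, Polynomial.coe_aeval_eq_eval] using
      (Polynomial.aeval_algHom_apply (MvPolynomial.aeval ![x, y]) (MvPolynomial.X 0) h₀).symm
  simp [hPoly, h]

lemma eval_h₁Poly (μ₁ μ₂ : 𝒪[K]) (d m : ℕ) (x y : 𝒪[K]) :
    MvPolynomial.eval ![x, y] (h₁Poly μ₁ μ₂ d m) = μ₁ * x ^ d + μ₂ * y ^ m := by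
  simp [h₁Poly]

lemma exists_eval_hPoly_eq (ϖ : 𝒪[K]) {μ₁ : 𝒪[K]} (hμ₁ : IsUnit μ₁) (μ₂ : 𝒪[K]) {d : ℕ} (m : ℕ)
    {h₀ : Polynomial 𝒪[K]} (hh₀ : ((d + 1 : ℕ) : ℕ∞) ≤ h₀.trailingDegree) :
    ∃ g : Polynomial 𝒪[K], g.eval 0 = 0 ∧
      ∀ x y, MvPolynomial.eval ![x, y] (hPoly ϖ μ₁ μ₂ d m h₀) =
        μ₁ * x ^ d * (1 + ϖ * g.eval x) + μ₂ * y ^ m := by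
  obtain ⟨g, rfl⟩ : Polynomial.X ^ (d + 1) ∣ h₀ := Polynomial.X_pow_dvd_iff.mpr fun k hk =>
    Polynomial.coeff_eq_zero_of_lt_trailingDegree ((Nat.cast_lt.mpr hk).trans_le hh₀)
  obtain ⟨u, rfl⟩ := hμ₁
  refine ⟨.C ((u⁻¹ : 𝒪[K]ˣ) : 𝒪[K]) * (.X * g), by simp, fun x y => ?_⟩
  simp only [eval_hPoly, Polynomial.eval_mul, Polynomial.eval_pow, Polynomial.eval_X,
    Polynomial.eval_C]
  linear_combination -(ϖ * x ^ (d + 1) * g.eval x) * u.mul_inv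

end Polynomial

section Zeta

variable {K : Type*} [Field K] [ValuativeRel K] [TopologicalSpace K]
  [IsNonarchimedeanLocalField K]

instance : T2Space 𝒪[K] := by
  let := IsTopologicalAddGroup.rightUniformSpace K
  have := isUniformAddGroup_of_addCommGroup (G := K)
  have : T0Space K := ValuedRing.separated
  infer_instance

lemma one_lt_residueCard : 1 < residueCard K := Finite.one_lt_card

lemma residueCard_ne_zero : (residueCard K : ℂ) ≠ 0 :=
  Nat.cast_ne_zero.mpr (zero_lt_one.trans one_lt_residueCard).ne'

lemma norm_residueCard_cpow_neg_lt_one {s : ℂ} (hs : 0 < s.re) :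
    ‖(residueCard K : ℂ) ^ (-s)‖ < 1 := by
  have hq := one_lt_residueCard (K := K)
  rw [Complex.norm_natCast_cpow_of_pos (zero_lt_one.trans hq)]
  exact Real.rpow_lt_one_of_one_lt_of_neg (by exact_mod_cast hq) (by simpa using hs)

lemma residueCard_cpow_neg_one_sub (s : ℂ) :
    (residueCard K : ℂ) ^ (-1 - s) = (residueCard K : ℂ)⁻¹ * (residueCard K : ℂ) ^ (-s) := by
  rw [sub_eq_add_neg, Complex.cpow_add _ _ residueCard_ne_zero, Complex.cpow_neg_one]

lemma residueCard_cpow_neg_sub_sub_mul (a b n : ℕ) (s : ℂ) :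
    (residueCard K : ℂ) ^ (-(b : ℂ) - a - n * s) =
      (residueCard K : ℂ)⁻¹ ^ (a + b) * ((residueCard K : ℂ) ^ (-s)) ^ n := by
  rw [← Complex.cpow_neg_one, ← Complex.cpow_nat_mul, ← Complex.cpow_nat_mul,
    ← Complex.cpow_add _ _ residueCard_ne_zero]
  congr 1
  push_cast
  ring

lemma angularComponent_unit_mul_pow {ϖ : 𝒪[K]} (hϖ : Irreducible ϖ) (u : 𝒪[K]ˣ) (k : ℕ) :
    angularComponent ϖ (u * ϖ ^ k) = u := by
  have h : ∃ v : 𝒪[K]ˣ, ∃ n : ℕ, (u * ϖ ^ k : 𝒪[K]) = v * ϖ ^ n := ⟨u, k, rfl⟩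
  rw [angularComponent, dif_pos h,
    ← IsDiscreteValuationRing.unit_mul_pow_congr_unit hϖ u _ k _ h.choose_spec.choose_spec]

lemma absVal_unit_mul_pow {ϖ : 𝒪[K]} (hϖ : Irreducible ϖ) (u : 𝒪[K]ˣ) (k : ℕ) :
    absVal (u * ϖ ^ k : 𝒪[K]) = ((residueCard K : ℝ)⁻¹) ^ k := by
  have hne : (u * ϖ ^ k : 𝒪[K]) ≠ 0 := mul_ne_zero u.ne_zero (pow_ne_zero k hϖ.ne_zero)
  rw [absVal, if_neg hne, IsDiscreteValuationRing.addVal_def _ u hϖ k rfl]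
  rfl

lemma ofUnitHom_angularComponent_mul_absVal_cpow {ϖ : 𝒪[K]} (hϖ : Irreducible ϖ)
    (χ : 𝒪[K]ˣ →* ℂˣ) {s : ℂ} (hs : s ≠ 0) (t : 𝒪[K]) :
    MulChar.ofUnitHom χ (angularComponent ϖ t) * (absVal t : ℂ) ^ s =
      quasiChar ϖ χ ((residueCard K : ℂ) ^ (-s)) t := by
  rcases eq_or_ne t 0 with rfl | ht
  · rw [quasiChar_zero hϖ, absVal, if_pos rfl, Complex.ofReal_zero, Complex.zero_cpow hs, mul_zero]
  · obtain ⟨k, u, rfl⟩ := IsDiscreteValuationRing.eq_unit_mul_pow_irreducible ht hϖ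
    have hpow : (((residueCard K : ℝ)⁻¹ ^ k : ℝ) : ℂ) ^ s = ((residueCard K : ℂ) ^ (-s)) ^ k := by
      rw [inv_pow, Complex.ofReal_inv, Complex.inv_cpow_ofReal_nonneg (by positivity),
        Complex.ofReal_pow, Complex.ofReal_natCast, ← Complex.natCast_cpow_natCast_mul,
        ← Complex.cpow_neg, ← mul_neg, Complex.cpow_nat_mul]
    rw [angularComponent_unit_mul_pow hϖ, absVal_unit_mul_pow hϖ, hpow, MulChar.ofUnitHom_coe,
      quasiChar_unit_mul_pow hϖ]

variable [MeasurableSpace K] [BorelSpace K]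

instance : (integerHaar K).IsAddHaarMeasure := by
  unfold integerHaar; infer_instance

instance : IsProbabilityMeasure (integerHaar K) :=
  ⟨Measure.addHaarMeasure_self⟩

variable {ϖ : 𝒪[K]} (hϖ : Irreducible ϖ)
include hϖ

lemma zeta_eq_integral_quasiChar (χ : 𝒪[K]ˣ →* ℂˣ) (f : MvPolynomial (Fin 2) 𝒪[K]) {s : ℂ}
    (hs : s ≠ 0) :
    zeta ϖ χ f s = ∫ p, quasiChar ϖ χ ((residueCard K : ℂ) ^ (-s))
      (MvPolynomial.eval ![p.1, p.2] f) ∂(integerHaar K).prod (integerHaar K) := by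
  rw [← (measurePreserving_finTwoArrow (integerHaar K)).integral_comp', zeta]
  refine integral_congr_ae (.of_forall fun x => ?_)
  have hx : ![(MeasurableEquiv.finTwoArrow x).1, (MeasurableEquiv.finTwoArrow x).2] = x := by
    ext i
    fin_cases i <;> rfl
  simp only [ofUnitHom_angularComponent_mul_absVal_cpow hϖ χ hs, hx]

variable {χ : 𝒪[K]ˣ →* ℂˣ} (hχ : Continuous χ) {d m : ℕ} {μ₁ μ₂ : 𝒪[K]} (hμ₁ : IsUnit μ₁)
  {h₀ : Polynomial 𝒪[K]} (hh₀ : ((d + 1 : ℕ) : ℕ∞) ≤ h₀.trailingDegree)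
include hχ hμ₁ hh₀

lemma exists_zeta_hPoly_eq_integral (hm : IsUnit (m : 𝒪[K])) :
    ∃ g : Polynomial 𝒪[K], g.eval 0 = 0 ∧
      ∀ s : ℂ, 0 < s.re → zeta ϖ χ (hPoly ϖ μ₁ μ₂ d m h₀) s =
        ∫ p, quasiChar ϖ χ 0 (1 + ϖ * g.eval p.1) *
          quasiChar ϖ χ ((residueCard K : ℂ) ^ (-s)) (μ₁ * p.1 ^ d + μ₂ * p.2 ^ m)
          ∂(integerHaar K).prod (integerHaar K) := by
  obtain ⟨g, hg_zero, hg⟩ := exists_eval_hPoly_eq ϖ hμ₁ μ₂ m hh₀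
  refine ⟨g, hg_zero, fun s hs => ?_⟩
  have := g.continuous
  simp only [zeta_eq_integral_quasiChar hϖ χ _ (Complex.ne_zero_of_re_pos hs), hg]
  exact integral_prod_quasiChar_mul_add_mul_pow hϖ _ hχ hm (norm_residueCard_cpow_neg_lt_one hs)
    (a := fun x => μ₁ * x ^ d) (v := fun x => 1 + ϖ * g.eval x) (by fun_prop) (by fun_prop)
    (by simp) μ₂

lemma exists_zeta_hPoly_eq_div_of_le_one (hm : IsUnit (m : 𝒪[K])) (hμ₂ : μ₂ ≠ 0) (hd : d ≤ 1) :
    ∃ H : Polynomial ℂ, ∀ s : ℂ, 0 < s.re → zeta ϖ χ (hPoly ϖ μ₁ μ₂ d m h₀) s =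
      H.eval ((residueCard K : ℂ) ^ (-s)) / (1 - (residueCard K : ℂ) ^ (-1 - s)) := by
  obtain ⟨g, -, hg⟩ := exists_eval_hPoly_eq ϖ hμ₁ μ₂ m hh₀
  obtain ⟨H, hH⟩ : ∃ H : Polynomial ℂ, ∀ z : ℂ, ‖z‖ < 1 →
      ∫ p, quasiChar ϖ χ z (μ₁ * p.1 ^ d * (1 + ϖ * g.eval p.1) + μ₂ * p.2 ^ m)
        ∂(integerHaar K).prod (integerHaar K) =
        H.eval z / (1 - (residueCard K : ℂ)⁻¹ * z) := by
    rcases Nat.le_one_iff_eq_zero_or_eq_one.mp hd with rfl | rfl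
    · have := g.continuous
      simp only [pow_zero, mul_one]
      exact exists_polynomial_integral_isUnit_add_mul_pow hϖ _ hχ hm hμ₂
        (w := fun x => μ₁ * (1 + ϖ * g.eval x)) (by fun_prop)
        fun x => hμ₁.mul (isUnit_one_add_mul hϖ _)
    · refine ⟨.C (∫ t, quasiChar ϖ χ 0 t ∂integerHaar K), fun z hz => ?_⟩
      have hw : Continuous fun y => μ₂ * y ^ m := by fun_prop
      rw [integral_prod_quasiChar_mul_pow_mul_add hϖ _ hχ (by simp) g μ₁ hw hz]
      simp only [pow_one]
      rw [integral_prod_quasiChar_mul_add hϖ _ hχ hμ₁ hw hz, integral_quasiChar hϖ _ hχ hz,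
        Polynomial.eval_C, residueCard]
  refine ⟨H, fun s hs => ?_⟩
  simpa only [zeta_eq_integral_quasiChar hϖ χ _ (Complex.ne_zero_of_re_pos hs),
    residueCard_cpow_neg_one_sub, hg] using hH _ (norm_residueCard_cpow_neg_lt_one hs)

lemma exists_zeta_hPoly_eq_div (hm : IsUnit (m : 𝒪[K])) (hμ₂ : μ₂ ≠ 0) (hd : d ≠ 0) :
    ∃ H : Polynomial ℂ, ∀ s : ℂ, 0 < s.re → zeta ϖ χ (hPoly ϖ μ₁ μ₂ d m h₀) s =
      H.eval ((residueCard K : ℂ) ^ (-s)) / ((1 - (residueCard K : ℂ) ^ (-1 - s)) *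
        (1 - (residueCard K : ℂ) ^ (-((d / d.gcd m : ℕ) : ℂ) - ((m / d.gcd m : ℕ) : ℂ) -
          ((d / d.gcd m : ℕ) : ℂ) * ((m / d.gcd m : ℕ) : ℂ) * ((d.gcd m : ℕ) : ℂ) * s))) := by
  have hm0 : m ≠ 0 := by rintro rfl; simp at hm
  have hd_gcd : d / d.gcd m * d.gcd m = d := Nat.div_mul_cancel (Nat.gcd_dvd_left d m)
  have hm_gcd : m / d.gcd m * d.gcd m = m := Nat.div_mul_cancel (Nat.gcd_dvd_right d m)
  have hdeg : d * (m / d.gcd m) = m * (d / d.gcd m) := by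
    linear_combination (d / d.gcd m) * hm_gcd - (m / d.gcd m) * hd_gcd
  have hexp : d / d.gcd m * (m / d.gcd m) * d.gcd m = d * (m / d.gcd m) := by
    linear_combination (m / d.gcd m) * hd_gcd
  obtain ⟨c, hc⟩ := exists_conductor hχ
  obtain ⟨g, hg_zero, hg⟩ := exists_zeta_hPoly_eq_integral hϖ hχ (μ₂ := μ₂) hμ₁ hh₀ hm
  have hψ_one (x : 𝒪[K]) (hx : x ∈ ball c 0) : quasiChar ϖ χ 0 (1 + ϖ * g.eval x) = 1 := by
    have hdvd : x ∣ g.eval x := by simpa [hg_zero] using Polynomial.sub_dvd_eval_sub x 0 g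
    rw [ball_zero] at hx
    exact quasiChar_one_add_mul_eq_one hϖ χ 0 hc (Ideal.mem_of_dvd _ (hdvd.mul_left ϖ) hx)
  have hψ : Continuous fun x => quasiChar ϖ χ 0 (1 + ϖ * g.eval x) := by
    have := g.continuous
    exact (continuous_quasiChar hϖ hχ (by simp)).comp (by fun_prop)
  obtain ⟨H, hH⟩ := exists_polynomial_integral_binomial hϖ (integerHaar K) hχ hμ₁ hμ₂ hd hm
    (Nat.div_ne_zero_iff_of_dvd (Nat.gcd_dvd_right d m) |>.mpr
      ⟨hm0, Nat.gcd_ne_zero_left hd⟩) hdeg hψ hψ_one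
  refine ⟨H, fun s hs => ?_⟩
  rw [hg s hs, residueCard_cpow_neg_one_sub, ← Nat.cast_mul, ← Nat.cast_mul,
    residueCard_cpow_neg_sub_sub_mul, hexp]
  exact hH _ (norm_residueCard_cpow_neg_lt_one hs)

lemma zeta_hPoly_eq_zeta_h₁Poly (hm : IsUnit (m : 𝒪[K]))
    (h : IsUnit (d : 𝒪[K]) ∨ ∀ u : 𝒪[K]ˣ, (u : 𝒪[K]) - 1 ∈ 𝓂[K] → χ u = 1) {s : ℂ}
    (hs : 0 < s.re) :
    zeta ϖ χ (hPoly ϖ μ₁ μ₂ d m h₀) s = zeta ϖ χ (h₁Poly μ₁ μ₂ d m) s := by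
  have hs0 : s ≠ 0 := Complex.ne_zero_of_re_pos hs
  rcases h with hd | htriv
  · obtain ⟨g, -, hg⟩ := exists_eval_hPoly_eq ϖ hμ₁ μ₂ m hh₀
    simp only [zeta_eq_integral_quasiChar hϖ χ _ hs0, eval_h₁Poly, hg]
    exact integral_prod_quasiChar_mul_pow_mul_add hϖ _ hχ hd g μ₁ (w := fun y => μ₂ * y ^ m)
      (by fun_prop) (norm_residueCard_cpow_neg_lt_one hs)
  · obtain ⟨g, -, hg⟩ := exists_zeta_hPoly_eq_integral hϖ hχ (μ₂ := μ₂) hμ₁ hh₀ hm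
    have hone (x : 𝒪[K]) : quasiChar ϖ χ 0 (1 + ϖ * g.eval x) = 1 :=
      quasiChar_one_add_mul_eq_one hϖ χ 0 htriv
        (Ideal.mul_mem_right _ _ ((mem_maximalIdeal ϖ).mpr hϖ.not_isUnit))
    simp only [hg s hs, zeta_eq_integral_quasiChar hϖ χ _ hs0, eval_h₁Poly, hone, one_mul]

end Zeta

end IgusaZeta

open IgusaZeta in
theorem theorem1p1_general
    {K : Type*} [Field K] [ValuativeRel K] [TopologicalSpace K] [IsNonarchimedeanLocalField K]
    [MeasurableSpace K] [BorelSpace K] {ϖ : 𝒪[K]} (hϖ : Irreducible ϖ)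
    {χ : 𝒪[K]ˣ →* ℂˣ} (hχ : Continuous χ) {d m : ℕ} (hm : IsUnit (m : 𝒪[K]))
    {μ₁ μ₂ : 𝒪[K]} (hμ₁ : IsUnit μ₁) (hμ₂ : μ₂ ≠ 0)
    {h₀ : Polynomial 𝒪[K]} (hh₀ : ((d + 1 : ℕ) : ℕ∞) ≤ h₀.trailingDegree) :
    (d ≤ 1 → ∃ H₁ : Polynomial ℂ, ∀ s : ℂ, 0 < s.re →
      zeta ϖ χ (hPoly ϖ μ₁ μ₂ d m h₀) s =
        H₁.eval ((residueCard K : ℂ) ^ (-s)) / (1 - (residueCard K : ℂ) ^ (-1 - s))) ∧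
    (d ≠ 0 → ∃ H₂ : Polynomial ℂ, ∀ s : ℂ, 0 < s.re →
      zeta ϖ χ (hPoly ϖ μ₁ μ₂ d m h₀) s =
        H₂.eval ((residueCard K : ℂ) ^ (-s)) /
          ((1 - (residueCard K : ℂ) ^ (-1 - s)) *
            (1 - (residueCard K : ℂ) ^ (-((d / d.gcd m : ℕ) : ℂ) - ((m / d.gcd m : ℕ) : ℂ) -
              ((d / d.gcd m : ℕ) : ℂ) * ((m / d.gcd m : ℕ) : ℂ) * ((d.gcd m : ℕ) : ℂ) * s)))) ∧
    ((IsUnit (d : 𝒪[K]) ∨ ∀ u : 𝒪[K]ˣ, (u : 𝒪[K]) - 1 ∈ 𝓂[K] → χ u = 1) →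
      ∀ s : ℂ, 0 < s.re →
        zeta ϖ χ (hPoly ϖ μ₁ μ₂ d m h₀) s = zeta ϖ χ (h₁Poly μ₁ μ₂ d m) s) :=
  ⟨exists_zeta_hPoly_eq_div_of_le_one hϖ hχ hμ₁ hh₀ hm hμ₂,
    exists_zeta_hPoly_eq_div hϖ hχ hμ₁ hh₀ hm hμ₂,
    fun h _ hs => zeta_hPoly_eq_zeta_h₁Poly hϖ hχ hμ₁ hh₀ hm h hs⟩

theorem theorem1p1
    {K : Type*} [Field K] [ValuativeRel K] [TopologicalSpace K] [IsNonarchimedeanLocalField K]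
    [MeasurableSpace K] [BorelSpace K]
    (p : ℕ) (hp : p.Prime) [CharP K p]
    (ϖ : 𝒪[K]) (hϖ : Irreducible ϖ)
    (χ : 𝒪[K]ˣ →* ℂˣ) (hχ : Continuous χ)
    (d m : ℕ) (hm : 2 ≤ m) (hpm : ¬ p ∣ m)
    (μ₁ μ₂ : 𝒪[K]) (hμ₁ : IsUnit μ₁) (hμ₂ : μ₂ ≠ 0)
    (h₀ : Polynomial 𝒪[K]) (hh₀ : ((d + 1 : ℕ) : ℕ∞) ≤ h₀.trailingDegree) :
    (d ≤ 1 → ∃ H₁ : Polynomial ℂ, ∀ s : ℂ, 0 < s.re →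
      IgusaZeta.zeta ϖ χ (IgusaZeta.hPoly ϖ μ₁ μ₂ d m h₀) s =
        H₁.eval ((IgusaZeta.residueCard K : ℂ) ^ (-s)) /
          (1 - (IgusaZeta.residueCard K : ℂ) ^ (-1 - s))) ∧
    (2 ≤ d → ∃ H₂ : Polynomial ℂ, ∀ s : ℂ, 0 < s.re →
      IgusaZeta.zeta ϖ χ (IgusaZeta.hPoly ϖ μ₁ μ₂ d m h₀) s =
        H₂.eval ((IgusaZeta.residueCard K : ℂ) ^ (-s)) /
          ((1 - (IgusaZeta.residueCard K : ℂ) ^ (-1 - s)) *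
            (1 - (IgusaZeta.residueCard K : ℂ) ^
              (-((d / d.gcd m : ℕ) : ℂ) - ((m / d.gcd m : ℕ) : ℂ) -
                ((d / d.gcd m : ℕ) : ℂ) * ((m / d.gcd m : ℕ) : ℂ) * ((d.gcd m : ℕ) : ℂ) * s)))) ∧
    (2 ≤ d → (¬ p ∣ d ∨ ∀ u : 𝒪[K]ˣ, (u : 𝒪[K]) - 1 ∈ 𝓂[K] → χ u = 1) →
      ∀ s : ℂ, 0 < s.re →
        IgusaZeta.zeta ϖ χ (IgusaZeta.hPoly ϖ μ₁ μ₂ d m h₀) s =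
          IgusaZeta.zeta ϖ χ (IgusaZeta.h₁Poly μ₁ μ₂ d m) s) := by
  obtain ⟨h₁, h₂, h₃⟩ := theorem1p1_general hϖ hχ (IgusaZeta.isUnit_natCast_of_not_dvd hp hpm)
    hμ₁ hμ₂ hh₀
  exact ⟨h₁, fun hd => h₂ (by omega),
    fun _ h => h₃ (h.imp_left (IgusaZeta.isUnit_natCast_of_not_dvd hp))⟩
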